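/- Let $A$ be a complex $2\times 2$ matrix, and put $$D_A=\det A-\tfrac14(\operatorname{tr}A)^2,\qquad U_A=\tfrac12\operatorname{tr}(A^*A)-\tfrac14|\operatorname{tr}A|^2,\qquad E_A=\Bigl(\tfrac{\operatorname{Im}\operatorname{tr}A}{2}\Bigr)^2+\tfrac12\bigl(|D_A|-\operatorname{Re}D_A\bigr).$$ Use the Beltrami--Cayley--Klein model of the hyperbolic plane: its points are the $(x,z)\in\mathbb R^2$ with $x^2+z^2<1$, and $$\mathrm d\bigl((x,z),(\tilde x,\tilde z)\bigr)=\operatorname{arcosh}\frac{1-x\tilde x-z\tilde z}{\sqrt{1-x^2-z^2}\,\sqrt{1-\tilde x^2-\tilde z^2}}.$$ The conformal range (real Davis--Wielandt shell) of $A$ is $$\mathrm{DW}^{\mathbb R}(A)=\left\{\left(\frac{2\operatorname{Re}\langle A\mathbf x,\mathbf x\rangle}{|A\mathbf x|^2+|\mathbf x|^2},\ \frac{|A\mathbf x|^2-|\mathbf x|^2}{|A\mathbf x|^2+|\mathbf x|^2}\right)\ :\ \mathbf x\in\mathbb C^2,\ \mathbf x\neq0\right\}.$$ Suppose that $A$ has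 no real eigenvalue. Let $\lambda_1,\lambda_2$ be its eigenvalues, counted with multiplicity, and let $$\Lambda_i=\left(\frac{2\operatorname{Re}\lambda_i}{|\lambda_i|^2+1},\ \frac{|\lambda_i|^2-1}{|\lambda_i|^2+1}\right)\qquad(i=1,2)$$ be its $h$-eigenpoints. Then $\Lambda_1,\Lambda_2$ are points of the hyperbolic plane, $|D_A|\neq E_A$, $\dfrac{U_A+E_A}{\bigl||D_A|-E_A\bigr|}\ge1$, and with $$m^+=\operatorname{arcosh}\frac{U_A+E_A}{\bigl||D_A|-E_A\bigr|}$$ the following hold. 1. $\mathrm{DW}^{\mathbb R}(A)$ is exactly the set of the points $\boldsymbol x$ of the hyperbolic plane with $\mathrm d(\boldsymbol x,\Lambda_1)+\mathrm d(\boldsymbol x,\Lambda_2)\le m^+$. 2. The topological boundary of $\mathrm{DW}^{\mathbb R}(A)$ is exactly the set of the points $\boldsymbol x$ of the hyperbolic plane with $\mathrm d(\boldsymbol x,\Lambda_1)+\mathrm d(\boldsymbol x,\Lambda_2)=m^+$. Moreover $m^+\ge\mathrm d(\Lambda_1,\Lambda_2)$, with strict inequality if and only if $A$ is not normal. Thus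 the boundary is the synthetic $h$-ellipse with foci $\Lambda_1,\Lambda_2$ and distance sum $m^+$ (degenerate exactly if $A$ is normal). 3. The distance sum $m^+$ is the length of the major axis of $\mathrm{DW}^{\mathbb R}(A)$: calling an $h$-segment $PQ\subseteq\mathrm{DW}^{\mathbb R}(A)$ a major axis if it is a diameter of a closed hyperbolic disk of minimal radius among the closed hyperbolic disks that contain $\mathrm{DW}^{\mathbb R}(A)$, a major axis exists, and every major axis has length $\mathrm d(P,Q)=m^+$. -/

import Mathlib

open scoped Matrix

noncomputable section

/-- The ordinary points of the hyperbolic plane in the Beltrami--Cayley--Klein model: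
the open unit disk. A pair `(x, z)` holds the two coordinates of a point. -/
def hPlane : Set (ℝ × ℝ) := {p | p.1 ^ 2 + p.2 ^ 2 < 1}

/-- The hyperbolic distance (curvature `-1`) of the Beltrami--Cayley--Klein model;
it is meaningful for points of `hPlane`. -/
def hDist (p q : ℝ × ℝ) : ℝ :=
  Real.arcosh ((1 - p.1 * q.1 - p.2 * q.2) /
    (Real.sqrt (1 - p.1 ^ 2 - p.2 ^ 2) * Real.sqrt (1 - q.1 ^ 2 - q.2 ^ 2)))

/-- The closed hyperbolic disk with centre `c` and radius `r`. -/
def hDisk (c : ℝ × ℝ) (r : ℝ) : Set (ℝ × ℝ) := {p ∈ hPlane | hDist c p ≤ r}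

/-- The parametrization of the (asymptotically closed) hyperbolic plane by complex numbers. -/
def hParam (l : ℂ) : ℝ × ℝ :=
  (2 * l.re / (‖l‖ ^ 2 + 1), (‖l‖ ^ 2 - 1) / (‖l‖ ^ 2 + 1))

/-- The conformal range (real Davis--Wielandt shell), in the Beltrami--Cayley--Klein model, of a
linear operator on a complex inner product space. -/
def conformalRange {H : Type*} [NormedAddCommGroup H] [InnerProductSpace ℂ H]
    (T : H →ₗ[ℂ] H) : Set (ℝ × ℝ) :=
  {p | ∃ x : H, x ≠ 0 ∧
    p = (2 * (inner ℂ (T x) x).re / (‖T x‖ ^ 2 + ‖x‖ ^ 2),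
      (‖T x‖ ^ 2 - ‖x‖ ^ 2) / (‖T x‖ ^ 2 + ‖x‖ ^ 2))}

/-- The conformal range of a complex `2 × 2` matrix, acting on `ℂ²` with its standard
Hermitian inner product. -/
def matrixConformalRange (A : Matrix (Fin 2) (Fin 2) ℂ) : Set (ℝ × ℝ) :=
  conformalRange (Matrix.toEuclideanLin A)

/-- The spectral discriminant `D_A`. -/
def discD (A : Matrix (Fin 2) (Fin 2) ℂ) : ℂ := A.det - A.trace ^ 2 / 4

/-- The metric discriminant `U_A`; the trace of `A* A` is real. -/
def discU (A : Matrix (Fin 2) (Fin 2) ℂ) : ℝ :=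
  (Aᴴ * A).trace.re / 2 - ‖A.trace‖ ^ 2 / 4

/-- The spectral quantity `E_A`. -/
def discE (A : Matrix (Fin 2) (Fin 2) ℂ) : ℝ :=
  (A.trace.im / 2) ^ 2 + (‖discD A‖ - (discD A).re) / 2

/-- The quantity `m⁺`. -/
def mPlus (A : Matrix (Fin 2) (Fin 2) ℂ) : ℝ :=
  Real.arcosh ((discU A + discE A) / |‖discD A‖ - discE A|)

/-- The synthetic `h`-ellipse with foci `F₁`, `F₂` and distance sum `m` (degenerate if `m` is
the distance of the foci). -/
def hEllipse (F₁ F₂ : ℝ × ℝ) (m : ℝ) : Set (ℝ × ℝ) :=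
  {p ∈ hPlane | hDist p F₁ + hDist p F₂ = m}

/-- The `h`-elliptical disk with foci `F₁`, `F₂` and distance sum `m` (degenerate if `m` is
the distance of the foci). -/
def hEllipticalDisk (F₁ F₂ : ℝ × ℝ) (m : ℝ) : Set (ℝ × ℝ) :=
  {p ∈ hPlane | hDist p F₁ + hDist p F₂ ≤ m}

/-- The `h`-segment from `P` to `Q` is a major axis of `S`: it lies in `S`, and it is a diameter
of a closed hyperbolic disk that has minimal radius among those that contain `S`.
(In this model `h`-segments are Euclidean segments.) -/
def IsMajorAxis (S : Set (ℝ × ℝ)) (P Q : ℝ × ℝ) : Prop :=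
  segment ℝ P Q ⊆ S ∧
  ∃ c ∈ segment ℝ P Q, ∃ r : ℝ, hDist c P = r ∧ hDist c Q = r ∧ S ⊆ hDisk c r ∧
    ∀ c' ∈ hPlane, ∀ r' : ℝ, S ⊆ hDisk c' r' → r ≤ r'

end

/-! All three claims reduce to upper triangular matrices. A unitary conjugation changes neither the
conformal range, nor normality, nor the discriminants, so Schur triangularization leaves `!![l₁, b;
0, l₂]` with nonreal `l₁`, `l₂`; it is normal exactly when `b = 0`. Here `|D| - E = -(im l₁ * im
l₂)`, and the ratio under the `arcosh` becomes `triangularCosh`, which exceeds the hyperbolic cosine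
of the focal distance by `‖b‖ ^ 2 / (2 * |l₁.im * l₂.im|)`. This settles well-definedness and the
degenerate case.

The range is computed fibrewise. After scaling to `|Ax|² + |x|² = 1`, a point `p` prescribes
`|Ax|²`, `|x|²` and `Re⟨Ax, x⟩`, and the vectors `x = (ξ, η)` over `p` are governed by a real
quadratic equation for `t = |η|²`. For `b ≠ 0` it is solvable exactly when its discriminant is
nonnegative (`exists_mem_Icc_iff_discrim`), and that discriminant is a positive multiple of
`ellipseForm` at `(1, p)`.

On the hyperboloid, the condition that the distance sum is at most `arcosh c` also reads `0 ≤
ellipseForm` (`hDist_add_iff_ellipseForm`), so the two sets coincide (`conformalRange_triangular`).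
For `b = 0` both are the segment between the foci. The boundary is the zero set of the form, because
the form is positive at a focus and negative on the unit circle. The major axis follows from the
triangle inequality and a midpoint estimate for arbitrary elliptical disks. -/

noncomputable section

/-! ### The hyperboloid over the Klein disk -/

/-- The Lorentz form of signature `(1, 2)`. -/
def mink (a b : ℝ × ℝ × ℝ) : ℝ := a.1 * b.1 - a.2.1 * b.2.1 - a.2.2 * b.2.2

/-- The upper sheet of the unit hyperboloid. -/
def hyperboloid : Set (ℝ × ℝ × ℝ) := {a | mink a a = 1 ∧ 0 < a.1}

/-- The central projection of the hyperboloid to the Klein disk. -/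
def kleinProj (a : ℝ × ℝ × ℝ) : ℝ × ℝ := (a.2.1 / a.1, a.2.2 / a.1)

lemma mink_comm (a b : ℝ × ℝ × ℝ) : mink a b = mink b a := by
  simp only [mink]; ring

lemma mink_add_left (a b c : ℝ × ℝ × ℝ) : mink (a + b) c = mink a c + mink b c := by
  simp only [mink, Prod.fst_add, Prod.snd_add]; ring

lemma mink_add_right (a b c : ℝ × ℝ × ℝ) : mink a (b + c) = mink a b + mink a c := by
  simp only [mink, Prod.fst_add, Prod.snd_add]; ring

lemma mink_smul_left (k : ℝ) (a b : ℝ × ℝ × ℝ) : mink (k • a) b = k * mink a b := by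
  simp only [mink, Prod.smul_fst, Prod.smul_snd, smul_eq_mul]; ring

lemma mink_smul_right (k : ℝ) (a b : ℝ × ℝ × ℝ) : mink a (k • b) = k * mink a b := by
  simp only [mink, Prod.smul_fst, Prod.smul_snd, smul_eq_mul]; ring

/-- The Gram determinant of three vectors is the square of their determinant times the determinant
of the form, which is `+1` in signature `(1, 2)`. Its nonnegativity yields both the triangle
inequality and the sign of `ellipseForm` at infinity. -/
lemma gram_identity (a b c : ℝ × ℝ × ℝ) :
    mink a a * mink b b * mink c c + 2 * mink a b * mink b c * mink c a
      - mink a a * mink b c ^ 2 - mink b b * mink c a ^ 2 - mink c c * mink a b ^ 2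
    = (a.1 * (b.2.1 * c.2.2 - b.2.2 * c.2.1) - a.2.1 * (b.1 * c.2.2 - b.2.2 * c.1)
        + a.2.2 * (b.1 * c.2.1 - b.2.1 * c.1)) ^ 2 := by
  simp only [mink]; ring

lemma kleinProj_mem {a : ℝ × ℝ × ℝ} (ha : a ∈ hyperboloid) : kleinProj a ∈ hPlane := by
  obtain ⟨h1, h2⟩ := ha
  simp only [mink] at h1
  simp only [hPlane, kleinProj, Set.mem_ofPred_eq, div_pow]
  rw [← add_div, div_lt_one (by positivity)]
  nlinarith

lemma one_sub_kleinProj {a : ℝ × ℝ × ℝ} (ha : a ∈ hyperboloid) :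
    Real.sqrt (1 - (kleinProj a).1 ^ 2 - (kleinProj a).2 ^ 2) = 1 / a.1 := by
  obtain ⟨h1, h2⟩ := ha
  simp only [mink] at h1
  have : 1 - (kleinProj a).1 ^ 2 - (kleinProj a).2 ^ 2 = (1 / a.1) ^ 2 := by
    simp only [kleinProj]
    field_simp
    linarith
  rw [this, Real.sqrt_sq (by positivity)]

lemma hDist_kleinProj {a b : ℝ × ℝ × ℝ} (ha : a ∈ hyperboloid) (hb : b ∈ hyperboloid) :
    hDist (kleinProj a) (kleinProj b) = Real.arcosh (mink a b) := by
  rw [hDist, one_sub_kleinProj ha, one_sub_kleinProj hb]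
  have h1 := ha.2
  have h2 := hb.2
  congr 1
  simp only [kleinProj, mink]
  field_simp

lemma exists_kleinProj_eq {p : ℝ × ℝ} (hp : p ∈ hPlane) : ∃ a ∈ hyperboloid, kleinProj a = p := by
  have hp' : 0 < 1 - p.1 ^ 2 - p.2 ^ 2 := by
    have : p.1 ^ 2 + p.2 ^ 2 < 1 := hp
    linarith
  set w := Real.sqrt (1 - p.1 ^ 2 - p.2 ^ 2) with hw
  have hw0 : 0 < w := Real.sqrt_pos.2 hp'
  have hw2 : w ^ 2 = 1 - p.1 ^ 2 - p.2 ^ 2 := Real.sq_sqrt hp'.le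
  refine ⟨(1 / w, p.1 / w, p.2 / w), ⟨?_, by positivity⟩, ?_⟩
  · simp only [mink]
    field_simp
    linarith
  · simp only [kleinProj]
    ext <;> simp only <;> field_simp

lemma one_le_mink {a b : ℝ × ℝ × ℝ} (ha : a ∈ hyperboloid) (hb : b ∈ hyperboloid) :
    1 ≤ mink a b := by
  obtain ⟨ha1, ha2⟩ := ha
  obtain ⟨hb1, hb2⟩ := hb
  simp only [mink] at *
  by_contra! h
  nlinarith [sq_nonneg (a.1 - b.1), sq_nonneg (a.2.1 - b.2.1), sq_nonneg (a.2.2 - b.2.2),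
    mul_pos ha2 hb2, sq_nonneg (a.1 * b.2.1 - a.2.1 * b.1), sq_nonneg (a.1 * b.2.2 - a.2.2 * b.1)]

/-- The difference `a - b` is null and orthogonal to the timelike vector `a`, hence zero. -/
lemma eq_of_mink_eq_one {a b : ℝ × ℝ × ℝ} (ha : a ∈ hyperboloid) (hb : b ∈ hyperboloid)
    (h : mink a b = 1) : a = b := by
  obtain ⟨ha1, ha2⟩ := ha
  obtain ⟨hb1, hb2⟩ := hb
  simp only [mink] at *
  have h0 : a.1 ^ 2 * ((a.2.1 - b.2.1) ^ 2 + (a.2.2 - b.2.2) ^ 2) =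
      (a.2.1 * (a.2.1 - b.2.1) + a.2.2 * (a.2.2 - b.2.2)) ^ 2 := by
    have e1 : a.1 * (a.1 - b.1) =
        a.2.1 * (a.2.1 - b.2.1) + a.2.2 * (a.2.2 - b.2.2) := by linarith
    have e2 : (a.1 - b.1) ^ 2 = (a.2.1 - b.2.1) ^ 2 + (a.2.2 - b.2.2) ^ 2 := by linarith
    rw [← e1, ← e2]; ring
  have h3 : 0 ≤ (a.2.1 * (a.2.2 - b.2.2) - a.2.2 * (a.2.1 - b.2.1)) ^ 2 := sq_nonneg _
  have h4 : (a.2.1 - b.2.1) ^ 2 + (a.2.2 - b.2.2) ^ 2 ≤ 0 := by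
    have e : a.1 ^ 2 = 1 + a.2.1 ^ 2 + a.2.2 ^ 2 := by linarith
    rw [e] at h0
    linarith
  have h5 : a.2.1 - b.2.1 = 0 := by
    apply pow_eq_zero_iff (two_ne_zero) |>.1
    nlinarith [sq_nonneg (a.2.2 - b.2.2), sq_nonneg (a.2.1 - b.2.1)]
  have h6 : a.2.2 - b.2.2 = 0 := by
    apply pow_eq_zero_iff (two_ne_zero) |>.1
    nlinarith [sq_nonneg (a.2.2 - b.2.2), sq_nonneg (a.2.1 - b.2.1)]
  have h7 : a.1 = b.1 := by
    have : (a.1 - b.1) ^ 2 = 0 := by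
      have e2 : (a.1 - b.1) ^ 2 = (a.2.1 - b.2.1) ^ 2 + (a.2.2 - b.2.2) ^ 2 := by linarith
      rw [e2, h5, h6]; ring
    have := pow_eq_zero_iff (two_ne_zero) |>.1 this
    linarith
  ext
  · exact h7
  · simpa [sub_eq_zero] using h5
  · simpa [sub_eq_zero] using h6

/-- Nonnegativity of the Gram determinant after completing the square. In terms of distances this is
the triangle inequality, since `u ^ 2 - 1` is the square of a hyperbolic sine. -/
lemma mink_gram_le {a b c : ℝ × ℝ × ℝ} (ha : a ∈ hyperboloid) (hb : b ∈ hyperboloid)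
    (hc : c ∈ hyperboloid) :
    (mink a c - mink a b * mink b c) ^ 2 ≤ (mink a b ^ 2 - 1) * (mink b c ^ 2 - 1) := by
  have h := gram_identity a b c
  rw [ha.1, hb.1, hc.1, mink_comm c a] at h
  nlinarith [sq_nonneg (a.1 * (b.2.1 * c.2.2 - b.2.2 * c.2.1) -
    a.2.1 * (b.1 * c.2.2 - b.2.2 * c.1) + a.2.2 * (b.1 * c.2.1 - b.2.1 * c.1))]

/-! ### Sums of distances and the triangle inequality -/

lemma cosh_arcosh_add {u v : ℝ} (hu : 1 ≤ u) (hv : 1 ≤ v) :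
    Real.cosh (Real.arcosh u + Real.arcosh v) = u * v + √((u ^ 2 - 1) * (v ^ 2 - 1)) := by
  rw [Real.cosh_add, Real.cosh_arcosh hu, Real.cosh_arcosh hv, Real.sinh_arcosh hu,
    Real.sinh_arcosh hv, Real.sqrt_mul (by nlinarith)]

lemma arcosh_add_le_iff {u v c : ℝ} (hu : 1 ≤ u) (hv : 1 ≤ v) (hc : 1 ≤ c) :
    Real.arcosh u + Real.arcosh v ≤ Real.arcosh c ↔
      u * v + √((u ^ 2 - 1) * (v ^ 2 - 1)) ≤ c := by
  rw [← cosh_arcosh_add hu hv]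
  have h := add_nonneg (Real.arcosh_nonneg hu) (Real.arcosh_nonneg hv)
  conv_rhs => rw [← Real.cosh_arcosh hc]
  rw [Real.cosh_le_cosh, abs_of_nonneg h, abs_of_nonneg (Real.arcosh_nonneg hc)]

lemma arcosh_add_eq_iff {u v c : ℝ} (hu : 1 ≤ u) (hv : 1 ≤ v) (hc : 1 ≤ c) :
    Real.arcosh u + Real.arcosh v = Real.arcosh c ↔
      u * v + √((u ^ 2 - 1) * (v ^ 2 - 1)) = c := by
  rw [← cosh_arcosh_add hu hv]
  have h := add_nonneg (Real.arcosh_nonneg hu) (Real.arcosh_nonneg hv)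
  constructor
  · intro e; rw [e, Real.cosh_arcosh hc]
  · intro e; rw [← e, Real.arcosh_cosh h]

lemma arcosh_le_add {u v f : ℝ} (hu : 1 ≤ u) (hv : 1 ≤ v) (hf : 1 ≤ f)
    (h : (f - u * v) ^ 2 ≤ (u ^ 2 - 1) * (v ^ 2 - 1)) :
    Real.arcosh f ≤ Real.arcosh u + Real.arcosh v := by
  have h0 := add_nonneg (Real.arcosh_nonneg hu) (Real.arcosh_nonneg hv)
  rw [← Real.arcosh_cosh h0, Real.arcosh_le_arcosh (by linarith) (Real.cosh_pos _),
    cosh_arcosh_add hu hv]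
  have := Real.le_sqrt_of_sq_le h
  linarith

lemma hDist_comm (p q : ℝ × ℝ) : hDist p q = hDist q p := by
  simp only [hDist]
  congr 1
  ring_nf

lemma hDist_triangle {p q r : ℝ × ℝ} (hp : p ∈ hPlane) (hq : q ∈ hPlane) (hr : r ∈ hPlane) :
    hDist p r ≤ hDist p q + hDist q r := by
  obtain ⟨a, ha, rfl⟩ := exists_kleinProj_eq hp
  obtain ⟨b, hb, rfl⟩ := exists_kleinProj_eq hq
  obtain ⟨c, hc, rfl⟩ := exists_kleinProj_eq hr
  rw [hDist_kleinProj ha hb, hDist_kleinProj hb hc, hDist_kleinProj ha hc]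
  exact arcosh_le_add (one_le_mink ha hb) (one_le_mink hb hc) (one_le_mink ha hc)
    (mink_gram_le ha hb hc)

lemma hDist_nonneg {p q : ℝ × ℝ} (hp : p ∈ hPlane) (hq : q ∈ hPlane) : 0 ≤ hDist p q := by
  obtain ⟨a, ha, rfl⟩ := exists_kleinProj_eq hp
  obtain ⟨b, hb, rfl⟩ := exists_kleinProj_eq hq
  rw [hDist_kleinProj ha hb]
  exact Real.arcosh_nonneg (one_le_mink ha hb)

/-! ### Segments and geodesics -/

lemma exists_of_mem_segment {a b c : ℝ × ℝ × ℝ} (ha : a ∈ hyperboloid) (hb : b ∈ hyperboloid)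
    (hc : c ∈ hyperboloid) (h : kleinProj c ∈ segment ℝ (kleinProj a) (kleinProj b)) :
    ∃ x y : ℝ, 0 ≤ x ∧ 0 ≤ y ∧ c = x • a + y • b := by
  obtain ⟨s, t, hs, ht, hst, e⟩ := h
  have ha0 := ha.2
  have hb0 := hb.2
  have hc0 := hc.2
  refine ⟨s * c.1 / a.1, t * c.1 / b.1, by positivity, by positivity, ?_⟩
  have e1 := congrArg Prod.fst e
  have e2 := congrArg Prod.snd e
  simp only [kleinProj, Prod.fst_add, Prod.snd_add, Prod.smul_fst, Prod.smul_snd,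
    smul_eq_mul] at e1 e2
  ext
  · simp only [Prod.fst_add, Prod.smul_fst, smul_eq_mul]
    field_simp
    linarith
  · simp only [Prod.fst_add, Prod.smul_fst, Prod.snd_add, Prod.smul_snd, smul_eq_mul]
    have : c.2.1 = c.1 * (c.2.1 / c.1) := by field_simp
    rw [this, ← e1]; ring
  · simp only [Prod.snd_add, Prod.smul_snd, smul_eq_mul]
    have : c.2.2 = c.1 * (c.2.2 / c.1) := by field_simp
    rw [this, ← e2]; ring

lemma kleinProj_mem_segment {a b c : ℝ × ℝ × ℝ} {x y k : ℝ} (ha : 0 < a.1) (hb : 0 < b.1)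
    (hc : 0 < c.1) (hx : 0 ≤ x) (hy : 0 ≤ y) (hk : 0 < k) (h : k • c = x • a + y • b) :
    kleinProj c ∈ segment ℝ (kleinProj a) (kleinProj b) := by
  have h1 := congrArg (fun z => z.1) h
  have h2 := congrArg (fun z => z.2.1) h
  have h3 := congrArg (fun z => z.2.2) h
  simp only [Prod.fst_add, Prod.smul_fst, Prod.snd_add, Prod.smul_snd, smul_eq_mul] at h1 h2 h3
  refine ⟨x * a.1 / (k * c.1), y * b.1 / (k * c.1), by positivity, by positivity, ?_, ?_⟩
  · rw [← add_div, ← h1, div_self (by positivity)]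
  · ext
    · simp only [kleinProj, Prod.fst_add, Prod.smul_fst, smul_eq_mul]
      field_simp
      linarith
    · simp only [kleinProj, Prod.snd_add, Prod.smul_snd, smul_eq_mul]
      field_simp
      linarith

lemma convex_hPlane : Convex ℝ hPlane := by
  intro p hp q hq s t hs ht hst
  simp only [hPlane, Set.mem_ofPred_eq] at *
  simp only [Prod.fst_add, Prod.smul_fst, Prod.snd_add, Prod.smul_snd, smul_eq_mul]
  have : (s * p.1 + t * q.1) ^ 2 + (s * p.2 + t * q.2) ^ 2 =
      s * (p.1 ^ 2 + p.2 ^ 2) + t * (q.1 ^ 2 + q.2 ^ 2)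
        - s * t * ((p.1 - q.1) ^ 2 + (p.2 - q.2) ^ 2) := by
    obtain rfl : s = 1 - t := by linarith
    ring
  rw [this]
  have h1 : 0 ≤ s * t * ((p.1 - q.1) ^ 2 + (p.2 - q.2) ^ 2) := by positivity
  rcases hs.eq_or_lt with rfl | hs'
  · obtain rfl : t = 1 := by linarith
    linarith
  · nlinarith

/-- The three lifts are coplanar, so the Gram determinant vanishes and the triangle inequality is
sharp. Nonnegative coefficients select the correct sign of the square root. -/
lemma hDist_add_of_mem_segment {p q x : ℝ × ℝ} (hp : p ∈ hPlane) (hq : q ∈ hPlane)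
    (hx : x ∈ segment ℝ p q) : hDist p x + hDist x q = hDist p q := by
  have hx' := convex_hPlane.segment_subset hp hq hx
  obtain ⟨a, ha, rfl⟩ := exists_kleinProj_eq hp
  obtain ⟨b, hb, rfl⟩ := exists_kleinProj_eq hq
  obtain ⟨c, hc, rfl⟩ := exists_kleinProj_eq hx'
  obtain ⟨x, y, hx0, hy0, e⟩ := exists_of_mem_segment ha hb hc hx
  rw [hDist_kleinProj ha hc, hDist_kleinProj hc hb, hDist_kleinProj ha hb,
    arcosh_add_eq_iff (one_le_mink ha hc) (one_le_mink hc hb) (one_le_mink ha hb)]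
  have h1 : mink a c = x + y * mink a b := by
    rw [e, mink_add_right, mink_smul_right, mink_smul_right, ha.1]; ring
  have h2 : mink c b = x * mink a b + y := by
    rw [e, mink_add_left, mink_smul_left, mink_smul_left, hb.1]; ring
  have h3 : x ^ 2 + y ^ 2 + 2 * x * y * mink a b = 1 := by
    have : mink c c = 1 := hc.1
    rw [e, mink_add_right, mink_smul_right, mink_smul_right, ← e, mink_comm c a, h1, h2] at this
    linarith
  have hf := one_le_mink ha hb
  rw [h1, h2]
  set f := mink a b
  have h4 : ((x + y * f) ^ 2 - 1) * ((x * f + y) ^ 2 - 1) = (x * y * (f ^ 2 - 1)) ^ 2 := by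
    have e1 : (x + y * f) ^ 2 - 1 = y ^ 2 * (f ^ 2 - 1) := by linarith
    have e2 : (x * f + y) ^ 2 - 1 = x ^ 2 * (f ^ 2 - 1) := by linarith
    rw [e1, e2]; ring
  rw [h4, Real.sqrt_sq (mul_nonneg (mul_nonneg hx0 hy0) (by nlinarith))]
  linear_combination f * h3

/-- The unit speed geodesic through `a` with unit tangent vector `e`. -/
def hGeodesic (a e : ℝ × ℝ × ℝ) (s : ℝ) : ℝ × ℝ × ℝ := Real.cosh s • a + Real.sinh s • e

/-- `e` is a unit tangent vector of the hyperboloid at `a`. -/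
structure IsUnitTangent (a e : ℝ × ℝ × ℝ) : Prop where
  mem : a ∈ hyperboloid
  orth : mink a e = 0
  unit : mink e e = -1

lemma IsUnitTangent.mink_geodesic {a e : ℝ × ℝ × ℝ} (h : IsUnitTangent a e) (s t : ℝ) :
    mink (hGeodesic a e s) (hGeodesic a e t) = Real.cosh (s - t) := by
  simp only [hGeodesic, mink_add_left, mink_add_right, mink_smul_left, mink_smul_right, h.mem.1,
    h.unit, h.orth, mink_comm e a, Real.cosh_sub]
  ring

lemma IsUnitTangent.geodesic_mem {a e : ℝ × ℝ × ℝ} (h : IsUnitTangent a e) (s : ℝ) :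
    hGeodesic a e s ∈ hyperboloid := by
  refine ⟨by rw [h.mink_geodesic, sub_self, Real.cosh_zero], ?_⟩
  obtain ⟨⟨h1, h0⟩, h2, h3⟩ := h
  simp only [mink] at h1 h2 h3
  simp only [hGeodesic, Prod.fst_add, Prod.smul_fst, smul_eq_mul]
  have hlt : |Real.sinh s| < Real.cosh s :=
    abs_lt_of_sq_lt_sq (by rw [Real.cosh_sq]; linarith) (Real.cosh_pos s).le
  -- Orthogonality and Cauchy–Schwarz for the spatial parts bound the time component of `e`. With
  -- `|sinh s| < cosh s` this keeps the geodesic on the upper sheet.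
  have he : |e.1| ≤ a.1 := by
    refine abs_le_of_sq_le_sq ?_ h0.le
    have : (a.1 * e.1) ^ 2 ≤ (a.1 ^ 2 - 1) * (e.1 ^ 2 + 1) := by
      have e1 : a.1 * e.1 = a.2.1 * e.2.1 + a.2.2 * e.2.2 := by linarith
      have e2 : a.1 ^ 2 - 1 = a.2.1 ^ 2 + a.2.2 ^ 2 := by linarith
      have e3 : e.1 ^ 2 + 1 = e.2.1 ^ 2 + e.2.2 ^ 2 := by linarith
      rw [e1, e2, e3]
      nlinarith [sq_nonneg (a.2.1 * e.2.2 - a.2.2 * e.2.1)]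
    nlinarith
  have h4 : |Real.sinh s * e.1| ≤ |Real.sinh s| * a.1 := by
    rw [abs_mul]; gcongr
  have h5 : |Real.sinh s| * a.1 < Real.cosh s * a.1 := by gcongr
  have := neg_abs_le (Real.sinh s * e.1)
  linarith

lemma hGeodesic_zero (a e : ℝ × ℝ × ℝ) : hGeodesic a e 0 = a := by
  simp [hGeodesic]

lemma IsUnitTangent.hDist_geodesic {a e : ℝ × ℝ × ℝ} (h : IsUnitTangent a e) (s t : ℝ) :
    hDist (kleinProj (hGeodesic a e s)) (kleinProj (hGeodesic a e t)) = |s - t| := by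
  rw [hDist_kleinProj (h.geodesic_mem s) (h.geodesic_mem t), h.mink_geodesic, ← Real.cosh_abs,
    Real.arcosh_cosh (abs_nonneg _)]

/-- The witness is the image of `(0, 1, 0)` under the Lorentz boost carrying `(1, 0, 0)` to `a`. -/
lemma exists_isUnitTangent {a : ℝ × ℝ × ℝ} (ha : a ∈ hyperboloid) : ∃ e, IsUnitTangent a e := by
  have h0 := ha.2
  have h1 := ha.1
  simp only [mink] at h1
  refine ⟨(a.2.1, 1 + a.2.1 ^ 2 / (1 + a.1), a.2.1 * a.2.2 / (1 + a.1)), ha, ?_, ?_⟩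
  · simp only [mink]
    field_simp
    linear_combination (a.2.1) * h1
  · simp only [mink]
    field_simp
    linear_combination (a.2.1 ^ 2) * h1

/-- Gram–Schmidt applied to `b` against `a` gives the direction; if `a = b`, any unit tangent
serves. -/
lemma exists_geodesic_eq {a b : ℝ × ℝ × ℝ} (ha : a ∈ hyperboloid) (hb : b ∈ hyperboloid) :
    ∃ e, IsUnitTangent a e ∧ hGeodesic a e (Real.arcosh (mink a b)) = b := by
  have hf := one_le_mink ha hb
  rcases hf.eq_or_lt with hf1 | hf1
  · obtain ⟨e, he⟩ := exists_isUnitTangent ha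
    refine ⟨e, he, ?_⟩
    rw [← hf1, Real.arcosh_zero, hGeodesic_zero]
    exact eq_of_mink_eq_one ha hb hf1.symm
  · have hpos : 0 < mink a b ^ 2 - 1 := by nlinarith
    have hw := Real.sq_sqrt hpos.le
    have hw0 := Real.sqrt_pos.2 hpos
    refine ⟨(√(mink a b ^ 2 - 1))⁻¹ • (b + (-mink a b) • a), ⟨ha, ?_, ?_⟩, ?_⟩
    · rw [mink_smul_right, mink_add_right, mink_smul_right, ha.1]; ring
    · simp only [mink_smul_right, mink_smul_left, mink_add_right, mink_add_left, ha.1, hb.1,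
        mink_comm b a]
      field_simp
      linarith
    · rw [hGeodesic, Real.cosh_arcosh hf, Real.sinh_arcosh hf, smul_smul,
        mul_inv_cancel₀ hw0.ne', one_smul]
      module

lemma IsUnitTangent.kleinProj_mem_segment {a e : ℝ × ℝ × ℝ} (h : IsUnitTangent a e)
    {s t u : ℝ} (hs : s ≤ t) (ht : t ≤ u) :
    kleinProj (hGeodesic a e t) ∈
      segment ℝ (kleinProj (hGeodesic a e s)) (kleinProj (hGeodesic a e u)) := by
  rcases (hs.trans ht).eq_or_lt with hsu | hsu
  · obtain rfl : s = t := by linarith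
    exact left_mem_segment _ _ _
  · refine _root_.kleinProj_mem_segment (x := Real.sinh (u - t)) (y := Real.sinh (t - s))
      (k := Real.sinh (u - s)) (h.geodesic_mem _).2 (h.geodesic_mem _).2 (h.geodesic_mem _).2
      (Real.sinh_nonneg_iff.2 (by linarith)) (Real.sinh_nonneg_iff.2 (by linarith))
      (Real.sinh_pos_iff.2 (by linarith)) ?_
    simp only [hGeodesic, smul_add, smul_smul]
    have hA : Real.sinh (u - s) * Real.cosh t =
        Real.sinh (u - t) * Real.cosh s + Real.sinh (t - s) * Real.cosh u := by
      simp only [Real.sinh_sub]; ring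
    have hB : Real.sinh (u - s) * Real.sinh t =
        Real.sinh (u - t) * Real.sinh s + Real.sinh (t - s) * Real.sinh u := by
      simp only [Real.sinh_sub]; ring
    rw [hA, hB]
    module

lemma IsUnitTangent.exists_of_mem_segment {a e : ℝ × ℝ × ℝ} (h : IsUnitTangent a e)
    {s u : ℝ} (hsu : s ≤ u) {p : ℝ × ℝ}
    (hp : p ∈ segment ℝ (kleinProj (hGeodesic a e s)) (kleinProj (hGeodesic a e u))) :
    ∃ t, s ≤ t ∧ t ≤ u ∧ p = kleinProj (hGeodesic a e t) := by
  have hps := kleinProj_mem (h.geodesic_mem s)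
  have hpu := kleinProj_mem (h.geodesic_mem u)
  have hp' := convex_hPlane.segment_subset hps hpu hp
  obtain ⟨c, hc, rfl⟩ := exists_kleinProj_eq hp'
  obtain ⟨x, y, -, -, hxy⟩ := _root_.exists_of_mem_segment (h.geodesic_mem s) (h.geodesic_mem u)
    hc hp
  have hd := hDist_add_of_mem_segment hps hpu hp
  have hcX : c = (x * Real.cosh s + y * Real.cosh u) • a
      + (x * Real.sinh s + y * Real.sinh u) • e := by
    rw [hxy]; simp only [hGeodesic]; module
  set X := x * Real.cosh s + y * Real.cosh u
  set Y := x * Real.sinh s + y * Real.sinh u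
  have h1 : X ^ 2 - Y ^ 2 = 1 := by
    have := hc.1
    rw [hcX] at this
    simp only [mink_add_left, mink_add_right, mink_smul_left, mink_smul_right, h.mem.1, h.unit,
      h.orth, mink_comm e a] at this
    linarith
  have hX : 0 < X := by
    have h2 : mink c a = X := by
      rw [hcX]
      simp only [mink_add_left, mink_smul_left, h.mem.1, h.orth, mink_comm e a]; ring
    have := one_le_mink hc h.mem
    linarith
  -- A unit vector `X • a + Y • e` with `X > 0` is parametrized by `arsinh Y`; additivity of
  -- distances then confines the parameter to `[s, u]`.
  have hcg : c = hGeodesic a e (Real.arsinh Y) := by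
    rw [hcX, hGeodesic, Real.sinh_arsinh, Real.cosh_arsinh]
    have : 1 + Y ^ 2 = X ^ 2 := by linarith
    rw [this, Real.sqrt_sq hX.le]
  rw [hcg, h.hDist_geodesic, h.hDist_geodesic, h.hDist_geodesic] at hd
  rw [abs_of_nonpos (by linarith : s - u ≤ 0)] at hd
  refine ⟨Real.arsinh Y, ?_, ?_, by rw [hcg]⟩
  · have h2 := le_abs_self (s - Real.arsinh Y)
    have h4 := neg_abs_le (Real.arsinh Y - u)
    linarith
  · have h3 := le_abs_self (Real.arsinh Y - u)
    have h4 := neg_abs_le (s - Real.arsinh Y)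
    linarith

/-- The two distances determine the products of `c` with `a` and `e`. Thus `c` has product `1` with
the geodesic point at parameter `d₁`, and so equals it. -/
lemma mem_segment_of_hDist_add {p q x : ℝ × ℝ} (hp : p ∈ hPlane) (hq : q ∈ hPlane)
    (hx : x ∈ hPlane) (h : hDist x p + hDist x q = hDist p q) : x ∈ segment ℝ p q := by
  obtain ⟨a, ha, rfl⟩ := exists_kleinProj_eq hp
  obtain ⟨b, hb, rfl⟩ := exists_kleinProj_eq hq
  obtain ⟨c, hc, rfl⟩ := exists_kleinProj_eq hx
  obtain ⟨e, he, hab⟩ := exists_geodesic_eq ha hb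
  rw [hDist_kleinProj hc ha, hDist_kleinProj hc hb, hDist_kleinProj ha hb] at h
  have hca := one_le_mink hc ha
  have hcb := one_le_mink hc hb
  set d := Real.arcosh (mink a b) with hd
  set d₁ := Real.arcosh (mink c a) with hd₁
  have h0 : 0 ≤ d₁ := Real.arcosh_nonneg hca
  have h0' : 0 ≤ Real.arcosh (mink c b) := Real.arcosh_nonneg hcb
  rcases (show 0 ≤ d by linarith).eq_or_lt with hd0 | hd0
  · have : c = a := eq_of_mink_eq_one hc ha ((Real.arcosh_eq_zero_iff hca).1 (by linarith))
    rw [this]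
    exact left_mem_segment _ _ _
  have hu : mink c a = Real.cosh d₁ := (Real.cosh_arcosh hca).symm
  have hv : mink c b = Real.cosh (d - d₁) := by
    rw [← h, add_sub_cancel_left, Real.cosh_arcosh hcb]
  have hs : 0 < Real.sinh d := Real.sinh_pos_iff.2 hd0
  have he' : mink c e = - Real.sinh d₁ := by
    rw [← hab, hGeodesic, mink_add_right, mink_smul_right, mink_smul_right, hu,
      Real.cosh_sub] at hv
    have : Real.sinh d * (mink c e + Real.sinh d₁) = 0 := by linarith
    rcases mul_eq_zero.1 this with h | h <;> linarith
  have hc1 : c = hGeodesic a e d₁ := by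
    apply eq_of_mink_eq_one hc (he.geodesic_mem d₁)
    rw [hGeodesic, mink_add_right, mink_smul_right, mink_smul_right, hu, he']
    linarith [Real.cosh_sq d₁]
  have := he.kleinProj_mem_segment h0 (show d₁ ≤ d by linarith)
  rwa [hab, hGeodesic_zero, ← hc1] at this

lemma hEllipticalDisk_hDist {p q : ℝ × ℝ} (hp : p ∈ hPlane) (hq : q ∈ hPlane) :
    hEllipticalDisk p q (hDist p q) = segment ℝ p q := by
  ext x
  constructor
  · rintro ⟨hx, h⟩
    refine mem_segment_of_hDist_add hp hq hx (le_antisymm h ?_)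
    rw [hDist_comm x p]
    exact hDist_triangle hp hx hq
  · intro h
    refine ⟨convex_hPlane.segment_subset hp hq h, ?_⟩
    rw [hDist_comm x p]
    exact (hDist_add_of_mem_segment hp hq h).le

lemma hEllipse_hDist {p q : ℝ × ℝ} (hp : p ∈ hPlane) (hq : q ∈ hPlane) :
    hEllipse p q (hDist p q) = segment ℝ p q := by
  ext x
  constructor
  · rintro ⟨hx, h⟩
    exact mem_segment_of_hDist_add hp hq hx h
  · intro h
    refine ⟨convex_hPlane.segment_subset hp hq h, ?_⟩
    rw [hDist_comm x p]
    exact hDist_add_of_mem_segment hp hq h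

lemma frontier_segment_prod (p q : ℝ × ℝ) : frontier (segment ℝ p q) = segment ℝ p q := by
  have hc : IsClosed (segment ℝ p q) := by
    rw [← convexHull_pair]
    exact ((Set.toFinite {p, q}).isCompact_convexHull ℝ).isClosed
  have hi : interior (segment ℝ p q) = ∅ := by
    rw [← Set.not_nonempty_iff_eq_empty, ← convexHull_pair,
      interior_convexHull_nonempty_iff_affineSpan_eq_top]
    intro h
    have h1 := collinear_pair ℝ p q
    rw [collinear_iff_finrank_le_one, ← direction_affineSpan, h,
      AffineSubspace.direction_top, finrank_top] at h1
    simp at h1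
  rw [hc.frontier_eq, hi, Set.sdiff_empty]

/-! ### Enclosing disks and the major axis -/

/-- The smallest hyperbolic disk about an elliptical disk is centred at the midpoint of the foci,
and the points of the focal line at distance `m / 2` from there bound a diameter. -/
lemma exists_diameter_hEllipticalDisk {p q : ℝ × ℝ} {m : ℝ} (hp : p ∈ hPlane) (hq : q ∈ hPlane)
    (hm : hDist p q ≤ m) :
    ∃ P Q c, segment ℝ P Q ⊆ hEllipticalDisk p q m ∧ c ∈ segment ℝ P Q ∧
      hDist c P = m / 2 ∧ hDist c Q = m / 2 ∧ hDist P Q = m ∧ c ∈ hPlane ∧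
      hEllipticalDisk p q m ⊆ hDisk c (m / 2) := by
  have hd0 := hDist_nonneg hp hq
  obtain ⟨a, ha, rfl⟩ := exists_kleinProj_eq hp
  obtain ⟨b, hb, rfl⟩ := exists_kleinProj_eq hq
  obtain ⟨e, he, hab⟩ := exists_geodesic_eq ha hb
  have ha' := hGeodesic_zero a e
  rw [hDist_kleinProj ha hb] at hm hd0
  set d := Real.arcosh (mink a b) with hd
  refine ⟨kleinProj (hGeodesic a e ((d - m) / 2)), kleinProj (hGeodesic a e ((d + m) / 2)),
    kleinProj (hGeodesic a e (d / 2)), ?_, he.kleinProj_mem_segment (by linarith) (by linarith),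
    ?_, ?_, ?_, kleinProj_mem (he.geodesic_mem _), ?_⟩
  · intro x hx
    obtain ⟨t, h1, h2, rfl⟩ := he.exists_of_mem_segment (by linarith) hx
    refine ⟨kleinProj_mem (he.geodesic_mem _), ?_⟩
    nth_rewrite 2 [← ha']
    rw [← hab, he.hDist_geodesic, he.hDist_geodesic]
    rcases abs_cases (t - 0) with h | h <;> rcases abs_cases (t - d) with h' | h' <;> linarith
  · rw [he.hDist_geodesic, abs_of_nonneg] <;> linarith
  · rw [he.hDist_geodesic, abs_of_nonpos] <;> linarith
  · rw [he.hDist_geodesic, abs_of_nonpos] <;> linarith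
  · rintro x ⟨hx, h⟩
    refine ⟨hx, ?_⟩
    have htri1 := hDist_triangle hx hp hq
    have htri2 := hDist_triangle hx hq hp
    obtain ⟨c, hc, rfl⟩ := exists_kleinProj_eq hx
    rw [hDist_comm (kleinProj b)] at htri2
    rw [hDist_kleinProj hc ha, hDist_kleinProj hc hb] at h htri1 htri2
    rw [hDist_kleinProj ha hb] at htri1 htri2
    rw [hDist_kleinProj (he.geodesic_mem _) hc]
    have hca := one_le_mink hc ha
    have hcb := one_le_mink hc hb
    have hu := Real.cosh_arcosh hca
    have hv := Real.cosh_arcosh hcb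
    set d₁ := Real.arcosh (mink c a)
    set d₂ := Real.arcosh (mink c b)
    -- The endpoints of a geodesic add up to `2 * cosh (d / 2)` times its midpoint.
    have hmid : (2 * Real.cosh (d / 2)) * mink (hGeodesic a e (d / 2)) c =
        Real.cosh d₁ + Real.cosh d₂ := by
      rw [hu, hv, ← hab]
      have e1 : Real.cosh d = 2 * Real.cosh (d / 2) ^ 2 - 1 := by
        have := Real.cosh_two_mul (d / 2)
        rw [Real.sinh_sq] at this
        rw [show 2 * (d / 2) = d by ring] at this
        linarith
      have e2 : Real.sinh d = 2 * Real.sinh (d / 2) * Real.cosh (d / 2) := by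
        rw [← Real.sinh_two_mul]; ring_nf
      simp only [hGeodesic, mink_add_left, mink_smul_left, mink_comm c, e1, e2]
      ring
    have hsum : Real.cosh d₁ + Real.cosh d₂ =
        2 * Real.cosh ((d₁ + d₂) / 2) * Real.cosh ((d₁ - d₂) / 2) := by
      have e1 : Real.cosh d₁ = Real.cosh ((d₁ + d₂) / 2 + (d₁ - d₂) / 2) := by ring_nf
      have e2 : Real.cosh d₂ = Real.cosh ((d₁ + d₂) / 2 - (d₁ - d₂) / 2) := by ring_nf
      rw [e1, e2, Real.cosh_add, Real.cosh_sub]; ring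
    -- The triangle inequality gives `|d₁ - d₂| ≤ d`, so the distance from the midpoint is at most
    -- the mean `(d₁ + d₂) / 2`.
    have hcd : Real.cosh ((d₁ - d₂) / 2) ≤ Real.cosh (d / 2) := by
      rw [Real.cosh_le_cosh, abs_of_nonneg (show 0 ≤ d / 2 by linarith), abs_le]
      constructor <;> linarith
    have hcm : Real.cosh ((d₁ + d₂) / 2) ≤ Real.cosh (m / 2) := by
      have h1 : 0 ≤ d₁ := Real.arcosh_nonneg hca
      have h2 : 0 ≤ d₂ := Real.arcosh_nonneg hcb
      rw [Real.cosh_le_cosh, abs_of_nonneg (by linarith), abs_of_nonneg (by linarith)]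
      linarith
    have hle : mink (hGeodesic a e (d / 2)) c ≤ Real.cosh (m / 2) := by
      refine le_trans ?_ hcm
      have hk := Real.cosh_pos (d / 2)
      have hk' := Real.cosh_pos ((d₁ + d₂) / 2)
      rw [hsum] at hmid
      refine le_of_mul_le_mul_left ?_ (show 0 < 2 * Real.cosh (d / 2) by linarith)
      rw [hmid]
      nlinarith
    have h1 := one_le_mink (he.geodesic_mem (d / 2)) hc
    rw [← Real.arcosh_cosh (show 0 ≤ m / 2 by linarith),
      Real.arcosh_le_arcosh (by linarith) (Real.cosh_pos _)]
    exact hle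

/-- Any enclosing disk contains two points at distance `m`, so its radius is at least `m / 2`, and
the midpoint disk attains this. A diameter of a minimal disk passes through the centre, hence has
length twice that radius. -/
theorem majorAxis_hEllipticalDisk {p q : ℝ × ℝ} {m : ℝ} (hp : p ∈ hPlane) (hq : q ∈ hPlane)
    (hm : hDist p q ≤ m) :
    (∃ P Q, IsMajorAxis (hEllipticalDisk p q m) P Q) ∧
    (∀ P Q, IsMajorAxis (hEllipticalDisk p q m) P Q → hDist P Q = m) := by
  obtain ⟨P, Q, c, hPQ, hc, hcP, hcQ, hd, hcp, hS⟩ := exists_diameter_hEllipticalDisk hp hq hm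
  have hmin : ∀ c' ∈ hPlane, ∀ r' : ℝ, hEllipticalDisk p q m ⊆ hDisk c' r' → m / 2 ≤ r' := by
    intro c' hc' r' h
    have h1 := h (hPQ (left_mem_segment ℝ P Q))
    have h2 := h (hPQ (right_mem_segment ℝ P Q))
    have h3 := hDist_triangle h1.1 hc' h2.1
    rw [hDist_comm P c'] at h3
    linarith [h1.2, h2.2]
  refine ⟨⟨P, Q, hPQ, c, hc, m / 2, hcP, hcQ, hS, hmin⟩, ?_⟩
  rintro P' Q' ⟨hPQ', c', hc', r, hcP', hcQ', hS', hmin'⟩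
  have hP' := (hPQ' (left_mem_segment ℝ P' Q')).1
  have hQ' := (hPQ' (right_mem_segment ℝ P' Q')).1
  have h1 := hmin c' (convex_hPlane.segment_subset hP' hQ' hc') r hS'
  have h2 := hmin' c hcp _ hS
  have h3 := hDist_add_of_mem_segment hP' hQ' hc'
  rw [hDist_comm P' c'] at h3
  linarith

/-! ### Elliptical disks as quadratic inequalities, and their boundary -/

/-- The quadratic form whose nonnegativity describes the elliptical disk with foci `a`, `b` and
distance sum `arcosh c`. -/
def ellipseForm (a b : ℝ × ℝ × ℝ) (c : ℝ) (v : ℝ × ℝ × ℝ) : ℝ :=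
  mink a v ^ 2 + mink b v ^ 2 - 2 * c * mink a v * mink b v + (c ^ 2 - 1) * mink v v

lemma ellipseForm_smul (a b : ℝ × ℝ × ℝ) (c k : ℝ) (v : ℝ × ℝ × ℝ) :
    ellipseForm a b c (k • v) = k ^ 2 * ellipseForm a b c v := by
  simp only [ellipseForm, mink_smul_left, mink_smul_right]; ring

lemma one_kleinProj {x : ℝ × ℝ × ℝ} (hx : 0 < x.1) : ((1 : ℝ), kleinProj x) = (x.1)⁻¹ • x := by
  ext
  · simp only [Prod.smul_fst, smul_eq_mul]; field_simp
  · simp only [kleinProj, Prod.smul_fst, Prod.smul_snd, smul_eq_mul]; field_simp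
  · simp only [kleinProj, Prod.smul_snd, smul_eq_mul]; field_simp

/-- The form factors as `(c - u * v + g) * (c - u * v - g)`. The Gram bound and `f < c` make the
first factor positive, so squaring introduces no spurious solutions. -/
lemma ellipse_ineq_iff {u v f c : ℝ} (hu : 1 ≤ u) (hv : 1 ≤ v)
    (hg : (f - u * v) ^ 2 ≤ (u ^ 2 - 1) * (v ^ 2 - 1)) (hfc : f < c) :
    (u * v + √((u ^ 2 - 1) * (v ^ 2 - 1)) ≤ c ↔
      0 ≤ u ^ 2 + v ^ 2 - 2 * c * u * v + (c ^ 2 - 1)) ∧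
    (u * v + √((u ^ 2 - 1) * (v ^ 2 - 1)) = c ↔
      u ^ 2 + v ^ 2 - 2 * c * u * v + (c ^ 2 - 1) = 0) := by
  set g := √((u ^ 2 - 1) * (v ^ 2 - 1)) with hgdef
  have hg0 : 0 ≤ g := Real.sqrt_nonneg _
  have hg2 : g ^ 2 = (u ^ 2 - 1) * (v ^ 2 - 1) :=
    Real.sq_sqrt (mul_nonneg (by nlinarith) (by nlinarith))
  rw [← hg2] at hg
  have hfg := abs_le.1 (abs_le_of_sq_le_sq hg hg0)
  have hpos : 0 < c - u * v + g := by linarith [hfg.1]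
  have key : u ^ 2 + v ^ 2 - 2 * c * u * v + (c ^ 2 - 1) = (c - u * v + g) * (c - u * v - g) := by
    linear_combination hg2
  rw [key]
  constructor
  · rw [mul_nonneg_iff_of_pos_left hpos]
    constructor <;> intro h <;> linarith
  · rw [mul_eq_zero_iff_left hpos.ne']
    constructor <;> intro h <;> linarith

lemma hDist_add_iff_ellipseForm {a b : ℝ × ℝ × ℝ} (ha : a ∈ hyperboloid) (hb : b ∈ hyperboloid)
    {c : ℝ} (hc : mink a b < c) {p : ℝ × ℝ} (hp : p ∈ hPlane) :
    (hDist p (kleinProj a) + hDist p (kleinProj b) ≤ Real.arcosh c ↔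
      0 ≤ ellipseForm a b c (1, p)) ∧
    (hDist p (kleinProj a) + hDist p (kleinProj b) = Real.arcosh c ↔
      ellipseForm a b c (1, p) = 0) := by
  obtain ⟨x, hx, rfl⟩ := exists_kleinProj_eq hp
  have hx0 := hx.2
  have hxa := one_le_mink hx ha
  have hxb := one_le_mink hx hb
  have hab := one_le_mink ha hb
  have hg := mink_gram_le ha hx hb
  rw [mink_comm a x] at hg
  have key := ellipse_ineq_iff hxa hxb hg hc
  rw [hDist_kleinProj hx ha, hDist_kleinProj hx hb,
    arcosh_add_le_iff hxa hxb (by linarith), arcosh_add_eq_iff hxa hxb (by linarith), key.1, key.2,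
    one_kleinProj hx0, ellipseForm_smul, mul_nonneg_iff_of_pos_left (by positivity),
    mul_eq_zero_iff_left (by positivity)]
  simp only [ellipseForm, hx.1, mul_one, mink_comm a x, mink_comm b x, and_self]

lemma mink_pos_of_sq_add_sq_le {a : ℝ × ℝ × ℝ} (ha : a ∈ hyperboloid) {p : ℝ × ℝ}
    (hp : p.1 ^ 2 + p.2 ^ 2 ≤ 1) : 0 < mink a (1, p) := by
  obtain ⟨h1, h0⟩ := ha
  simp only [mink, mul_one] at *
  have h2 : (a.2.1 * p.1 + a.2.2 * p.2) ^ 2 ≤ (a.2.1 ^ 2 + a.2.2 ^ 2) * 1 := by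
    nlinarith [sq_nonneg (a.2.1 * p.2 - a.2.2 * p.1), sq_nonneg a.2.1, sq_nonneg a.2.2]
  have h3 := abs_lt.1 (abs_lt_of_sq_lt_sq (show (a.2.1 * p.1 + a.2.2 * p.2) ^ 2 < a.1 ^ 2 by
    linarith) h0.le)
  linarith [h3.2]

/-- At a null vector the Gram identity gives `u ^ 2 + v ^ 2 ≤ 2 * mink a b * u * v`, and `mink a b <
c` makes the form negative. Hence ideal points never satisfy the inequality, and the disk is closed
in the plane. -/
lemma ellipseForm_neg_of_sq_add_sq_eq {a b : ℝ × ℝ × ℝ} (ha : a ∈ hyperboloid)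
    (hb : b ∈ hyperboloid) {c : ℝ} (hc : mink a b < c) {p : ℝ × ℝ} (hp : p.1 ^ 2 + p.2 ^ 2 = 1) :
    ellipseForm a b c (1, p) < 0 := by
  have h1 := mink_pos_of_sq_add_sq_le ha hp.le
  have h2 := mink_pos_of_sq_add_sq_le hb hp.le
  have h3 : mink (1, p) (1, p) = 0 := by simp only [mink]; linarith
  have hg := gram_identity a b (1, p)
  rw [ha.1, hb.1, h3, mink_comm (1, p) a] at hg
  rw [ellipseForm, h3]
  have h4 : 0 < (c - mink a b) * (mink a (1, p) * mink b (1, p)) :=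
    mul_pos (by linarith) (mul_pos h1 h2)
  nlinarith [sq_nonneg (a.1 * (b.2.1 * p.2 - b.2.2 * p.1) -
    a.2.1 * (b.1 * p.2 - b.2.2 * 1) + a.2.2 * (b.1 * p.1 - b.2.1 * 1))]

lemma hEllipticalDisk_eq_of_lt {a b : ℝ × ℝ × ℝ} (ha : a ∈ hyperboloid) (hb : b ∈ hyperboloid)
    {c : ℝ} (hc : mink a b < c) :
    hEllipticalDisk (kleinProj a) (kleinProj b) (Real.arcosh c) =
      {p | p.1 ^ 2 + p.2 ^ 2 ≤ 1 ∧ 0 ≤ ellipseForm a b c (1, p)} := by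
  ext p
  constructor
  · rintro ⟨hp, h⟩
    exact ⟨le_of_lt hp, (hDist_add_iff_ellipseForm ha hb hc hp).1.1 h⟩
  · rintro ⟨hp, h⟩
    have hp' : p ∈ hPlane := by
      refine lt_of_le_of_ne hp fun h' => ?_
      linarith [ellipseForm_neg_of_sq_add_sq_eq ha hb hc h']
    exact ⟨hp', (hDist_add_iff_ellipseForm ha hb hc hp').1.2 h⟩

lemma ellipseForm_focus {a b : ℝ × ℝ × ℝ} (ha : a ∈ hyperboloid)
    {c : ℝ} (hc : mink a b < c) : 0 < ellipseForm a b c (1, kleinProj a) := by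
  have h0 := ha.2
  rw [one_kleinProj h0, ellipseForm_smul]
  refine mul_pos (by positivity) ?_
  rw [ellipseForm, ha.1, mink_comm b a]
  nlinarith [mul_pos (sub_pos.2 hc) (sub_pos.2 hc)]

lemma exists_unit_circle_ray {p q : ℝ × ℝ} (hp : p ∈ hPlane) (hq : q ∈ hPlane) (hpq : p ≠ q) :
    ∃ n : ℝ × ℝ, n.1 ^ 2 + n.2 ^ 2 = 1 ∧ ∃ t : ℝ, 0 < t ∧ t < 1 ∧ q = (1 - t) • p + t • n := by
  have hp1 : p.1 ^ 2 + p.2 ^ 2 < 1 := hp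
  set A := (q.1 - p.1) ^ 2 + (q.2 - p.2) ^ 2 with hA
  set B := p.1 * (q.1 - p.1) + p.2 * (q.2 - p.2) with hB
  have hA0 : 0 < A := by
    refine lt_of_le_of_ne (by positivity) fun h => hpq ?_
    ext
    · nlinarith [sq_nonneg (q.1 - p.1), sq_nonneg (q.2 - p.2)]
    · nlinarith [sq_nonneg (q.1 - p.1), sq_nonneg (q.2 - p.2)]
  set r := √(B ^ 2 + A * (1 - p.1 ^ 2 - p.2 ^ 2)) with hr
  have hpos : 0 < A * (1 - p.1 ^ 2 - p.2 ^ 2) := mul_pos hA0 (by linarith)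
  have hr2 : r ^ 2 = B ^ 2 + A * (1 - p.1 ^ 2 - p.2 ^ 2) :=
    Real.sq_sqrt (by positivity)
  have hrB : |B| < r := abs_lt_of_sq_lt_sq (by linarith) (Real.sqrt_nonneg _)
  -- The positive root of `|p + s (q - p)|² = 1`; the required `t` is `1 / s`.
  set s := (r - B) / A with hs
  have hs0 : 0 < s := div_pos (by linarith [le_abs_self B]) hA0
  have hsA : s * A = r - B := by rw [hs]; field_simp
  have hn : (p.1 + s * (q.1 - p.1)) ^ 2 + (p.2 + s * (q.2 - p.2)) ^ 2 = 1 := by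
    have h1 : A * ((p.1 + s * (q.1 - p.1)) ^ 2 + (p.2 + s * (q.2 - p.2)) ^ 2) = A * 1 := by
      have : A * ((p.1 + s * (q.1 - p.1)) ^ 2 + (p.2 + s * (q.2 - p.2)) ^ 2) =
          A * (p.1 ^ 2 + p.2 ^ 2) + 2 * (s * A) * B + (s * A) ^ 2 := by
        rw [hB, hA]; ring
      rw [this, hsA]
      linear_combination hr2
    exact mul_left_cancel₀ hA0.ne' h1
  have hs1 : 1 < s := by
    by_contra! h
    have hmem : (1 - s) • p + s • q ∈ hPlane :=
      convex_hPlane hp hq (by linarith) hs0.le (by ring)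
    have : ((1 - s) * p.1 + s * q.1) ^ 2 + ((1 - s) * p.2 + s * q.2) ^ 2 < 1 := hmem
    rw [show (1 - s) * p.1 + s * q.1 = p.1 + s * (q.1 - p.1) by ring,
      show (1 - s) * p.2 + s * q.2 = p.2 + s * (q.2 - p.2) by ring, hn] at this
    exact lt_irrefl _ this
  refine ⟨(p.1 + s * (q.1 - p.1), p.2 + s * (q.2 - p.2)), hn, 1 / s, by positivity,
    (div_lt_one hs0).2 hs1, ?_⟩
  ext
  · simp only [Prod.fst_add, Prod.smul_fst, smul_eq_mul]
    field_simp
    ring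
  · simp only [Prod.snd_add, Prod.smul_snd, smul_eq_mul]
    field_simp
    ring

lemma ellipseForm_segment (a b : ℝ × ℝ × ℝ) (c : ℝ) (p q : ℝ × ℝ) : ∃ k : ℝ, ∀ t : ℝ,
    ellipseForm a b c (1, (1 - t) • p + t • q) = (1 - t) ^ 2 * ellipseForm a b c (1, p)
      + t * (1 - t) * k + t ^ 2 * ellipseForm a b c (1, q) := by
  refine ⟨2 * (mink a (1, p) * mink a (1, q) + mink b (1, p) * mink b (1, q)
    - c * (mink a (1, p) * mink b (1, q) + mink a (1, q) * mink b (1, p))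
    + (c ^ 2 - 1) * mink (1, p) (1, q)), fun t => ?_⟩
  have : ((1 : ℝ), (1 - t) • p + t • q) = (1 - t) • (1, p) + t • (1, q) := by
    ext <;> simp
  rw [this]
  simp only [ellipseForm, mink_add_left, mink_add_right, mink_smul_left, mink_smul_right,
    mink_comm (1, q) (1, p)]
  ring

lemma frontier_hEllipticalDisk_of_lt {a b : ℝ × ℝ × ℝ} (ha : a ∈ hyperboloid)
    (hb : b ∈ hyperboloid) {c : ℝ} (hc : mink a b < c) :
    frontier (hEllipticalDisk (kleinProj a) (kleinProj b) (Real.arcosh c)) =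
      hEllipse (kleinProj a) (kleinProj b) (Real.arcosh c) := by
  have hcont : Continuous fun p : ℝ × ℝ => ellipseForm a b c (1, p) := by
    simp only [ellipseForm, mink]; fun_prop
  have hcont' : Continuous fun p : ℝ × ℝ => p.1 ^ 2 + p.2 ^ 2 := by fun_prop
  have hclosed : IsClosed (hEllipticalDisk (kleinProj a) (kleinProj b) (Real.arcosh c)) := by
    rw [hEllipticalDisk_eq_of_lt ha hb hc]
    exact (isClosed_le hcont' continuous_const).inter (isClosed_le continuous_const hcont)
  rw [hclosed.frontier_eq]
  ext p
  constructor
  · rintro ⟨⟨hp, h⟩, hi⟩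
    refine ⟨hp, (hDist_add_iff_ellipseForm ha hb hc hp).2.2 ?_⟩
    by_contra hne
    have h0 := lt_of_le_of_ne ((hDist_add_iff_ellipseForm ha hb hc hp).1.1 h) (Ne.symm hne)
    refine hi (mem_interior.2 ⟨{p | p.1 ^ 2 + p.2 ^ 2 < 1 ∧ 0 < ellipseForm a b c (1, p)}, ?_,
      (isOpen_lt hcont' continuous_const).inter (isOpen_lt continuous_const hcont), hp, h0⟩)
    rintro x ⟨hx, hx'⟩
    exact ⟨hx, (hDist_add_iff_ellipseForm ha hb hc hx).1.2 hx'.le⟩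
  · rintro ⟨hp, h⟩
    refine ⟨⟨hp, h.le⟩, fun hi => ?_⟩
    have h0 := (hDist_add_iff_ellipseForm ha hb hc hp).2.1 h
    have hF := ellipseForm_focus ha hc
    have hne : kleinProj a ≠ p := by rintro rfl; linarith
    -- Follow the ray from a focus through `p` to the unit circle. The form is quadratic along it,
    -- positive at the start, negative at the end and zero at `p`, hence negative just beyond `p`,
    -- which is impossible if `p` is interior.
    obtain ⟨n, hn, t, ht0, ht1, hpt⟩ := exists_unit_circle_ray (kleinProj_mem ha) hp hne
    obtain ⟨k, hk⟩ := ellipseForm_segment a b c (kleinProj a) n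
    have hn' := ellipseForm_neg_of_sq_add_sq_eq ha hb hc hn
    have hpath : Continuous fun s : ℝ => (1 - s) • kleinProj a + s • n := by fun_prop
    have hev : ∀ᶠ s in nhds t, (1 - s) • kleinProj a + s • n ∈
        interior (hEllipticalDisk (kleinProj a) (kleinProj b) (Real.arcosh c)) := by
      refine hpath.continuousAt.eventually (isOpen_interior.mem_nhds ?_)
      rw [hpt] at hi
      exact hi
    obtain ⟨s, hs, hs1, hs2⟩ :=
      ((hev.filter_mono nhdsWithin_le_nhds).and (Ioo_mem_nhdsGT ht1)).exists
    have hmem := interior_subset hs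
    have hge := (hDist_add_iff_ellipseForm ha hb hc hmem.1).1.1 hmem.2
    rw [hk] at hge
    rw [hpt, hk] at h0
    set X := ellipseForm a b c (1, kleinProj a)
    set Y := ellipseForm a b c (1, n)
    -- The vanishing at parameter `t` eliminates the middle coefficient `k`.
    have e : t * (1 - t) * ((1 - s) ^ 2 * X + s * (1 - s) * k + s ^ 2 * Y) =
        (s - t) * (-(X * ((1 - t) * (1 - s))) + Y * (t * s)) := by
      linear_combination s * (1 - s) * h0
    have h1 : 0 < X * ((1 - t) * (1 - s)) :=
      mul_pos hF (mul_pos (by linarith) (by linarith))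
    have h2 : Y * (t * s) < 0 := mul_neg_of_neg_of_pos hn' (mul_pos ht0 (by linarith))
    have h3 : (s - t) * (-(X * ((1 - t) * (1 - s))) + Y * (t * s)) < 0 :=
      mul_neg_of_pos_of_neg (by linarith) (by linarith)
    have h4 : 0 ≤ t * (1 - t) * ((1 - s) ^ 2 * X + s * (1 - s) * k + s ^ 2 * Y) :=
      mul_nonneg (mul_nonneg ht0.le (by linarith)) hge
    linarith

/-! ### The conformal range of a triangular matrix -/

/-- The point of the hyperboloid over `hParam l`. -/
def focusVec (l : ℂ) : ℝ × ℝ × ℝ :=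
  ((l.re ^ 2 + l.im ^ 2 + 1) / (2 * |l.im|), 2 * l.re / (2 * |l.im|),
    (l.re ^ 2 + l.im ^ 2 - 1) / (2 * |l.im|))

lemma Complex.norm_sq_eq_re_im (l : ℂ) : ‖l‖ ^ 2 = l.re ^ 2 + l.im ^ 2 := by
  rw [Complex.sq_norm, Complex.normSq_apply]; ring

lemma focusVec_mem {l : ℂ} (hl : l.im ≠ 0) : focusVec l ∈ hyperboloid := by
  have h0 : 0 < |l.im| := abs_pos.2 hl
  refine ⟨?_, by simp only [focusVec]; positivity⟩
  simp only [mink, focusVec]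
  field_simp
  rw [sq_abs]; ring

lemma kleinProj_focusVec {l : ℂ} (hl : l.im ≠ 0) : kleinProj (focusVec l) = hParam l := by
  have h0 : 0 < |l.im| := abs_pos.2 hl
  have h1 : 0 < l.re ^ 2 + l.im ^ 2 + 1 := by positivity
  simp only [kleinProj, focusVec, hParam, Complex.norm_sq_eq_re_im]
  ext <;> simp only <;> field_simp

lemma mink_focusVec {l₁ l₂ : ℂ} (h₁ : l₁.im ≠ 0) (h₂ : l₂.im ≠ 0) :
    mink (focusVec l₁) (focusVec l₂) =
      ((l₁.re - l₂.re) ^ 2 + l₁.im ^ 2 + l₂.im ^ 2) / (2 * |l₁.im * l₂.im|) := by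
  have h1 : 0 < |l₁.im| := abs_pos.2 h₁
  have h2 : 0 < |l₂.im| := abs_pos.2 h₂
  rw [abs_mul]
  simp only [mink, focusVec]
  field_simp
  ring

/-- Moduli and the product `b * η * star ξ` can be prescribed together as soon as they are
compatible: take `ξ` real and solve for `η`. -/
lemma exists_sq_norm_eq {b v : ℂ} {s t : ℝ} (hs : 0 ≤ s) (ht : 0 ≤ t)
    (h : ‖v‖ ^ 2 = ‖b‖ ^ 2 * (s * t)) :
    ∃ ξ η : ℂ, ‖ξ‖ ^ 2 = s ∧ ‖η‖ ^ 2 = t ∧ b * η * star ξ = v := by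
  have hsq : ∀ r : ℝ, 0 ≤ r → ‖((√r : ℝ) : ℂ)‖ ^ 2 = r := fun r hr => by
    rw [Complex.norm_real, Real.norm_eq_abs, sq_abs, Real.sq_sqrt hr]
  by_cases h0 : b = 0 ∨ s = 0
  · have hv : v = 0 := by
      have : ‖v‖ ^ 2 = 0 := by rcases h0 with h0 | h0 <;> simp [h, h0]
      simpa using this
    refine ⟨(√s : ℝ), (√t : ℝ), hsq s hs, hsq t ht, ?_⟩
    rcases h0 with h0 | h0 <;> simp [h0, hv]
  · push Not at h0
    have hs' : 0 < s := lt_of_le_of_ne hs (Ne.symm h0.2)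
    have hr : ((√s : ℝ) : ℂ) ≠ 0 := by
      rw [Complex.ofReal_ne_zero]; exact (Real.sqrt_pos.2 hs').ne'
    have hb := norm_pos_iff.2 h0.1
    refine ⟨(√s : ℝ), v / (b * (√s : ℝ)), hsq s hs, ?_, ?_⟩
    · rw [norm_div, norm_mul, div_pow, mul_pow, hsq s hs, h]
      field_simp
    · rw [Complex.star_def, Complex.conj_ofReal]
      have := h0.1
      field_simp

/-- The equation for `t = |η|²` satisfied by the unit vectors `(ξ, η)` in the fibre over a point
of the conformal range of an upper triangular matrix. -/
def fibreEq (l₁ l₂ b : ℂ) (P Q R t : ℝ) : Prop :=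
  4 * l₁.im ^ 2 * (Q - l₁.re * R - (l₂.re - l₁.re) * t) ^ 2 +
    (P - ‖l₁‖ ^ 2 * (R - t) - (‖b‖ ^ 2 + ‖l₂‖ ^ 2) * t
      - 2 * l₁.re * (Q - l₁.re * R - (l₂.re - l₁.re) * t)) ^ 2 =
    4 * l₁.im ^ 2 * (‖b‖ ^ 2 * ((R - t) * t))

lemma mem_conformalRange_iff (l₁ l₂ b : ℂ) (p : ℝ × ℝ) :
    p ∈ matrixConformalRange !![l₁, b; 0, l₂] ↔ ∃ ξ η : ℂ, (ξ ≠ 0 ∨ η ≠ 0) ∧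
      p = (2 * (l₁.re * ‖ξ‖ ^ 2 + l₂.re * ‖η‖ ^ 2 + (b * η * star ξ).re) /
          ((‖l₁‖ ^ 2 * ‖ξ‖ ^ 2 + (‖b‖ ^ 2 + ‖l₂‖ ^ 2) * ‖η‖ ^ 2 +
            2 * (l₁.re * (b * η * star ξ).re + l₁.im * (b * η * star ξ).im)) +
            (‖ξ‖ ^ 2 + ‖η‖ ^ 2)),
        ((‖l₁‖ ^ 2 * ‖ξ‖ ^ 2 + (‖b‖ ^ 2 + ‖l₂‖ ^ 2) * ‖η‖ ^ 2 +
            2 * (l₁.re * (b * η * star ξ).re + l₁.im * (b * η * star ξ).im)) -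
            (‖ξ‖ ^ 2 + ‖η‖ ^ 2)) /
          ((‖l₁‖ ^ 2 * ‖ξ‖ ^ 2 + (‖b‖ ^ 2 + ‖l₂‖ ^ 2) * ‖η‖ ^ 2 +
            2 * (l₁.re * (b * η * star ξ).re + l₁.im * (b * η * star ξ).im)) +
            (‖ξ‖ ^ 2 + ‖η‖ ^ 2))) := by
  have key : ∀ x : EuclideanSpace ℂ (Fin 2),
      (inner ℂ (Matrix.toEuclideanLin !![l₁, b; 0, l₂] x) x).re =
        l₁.re * ‖x 0‖ ^ 2 + l₂.re * ‖x 1‖ ^ 2 + (b * x 1 * star (x 0)).re ∧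
      ‖Matrix.toEuclideanLin !![l₁, b; 0, l₂] x‖ ^ 2 =
        ‖l₁‖ ^ 2 * ‖x 0‖ ^ 2 + (‖b‖ ^ 2 + ‖l₂‖ ^ 2) * ‖x 1‖ ^ 2 +
          2 * (l₁.re * (b * x 1 * star (x 0)).re + l₁.im * (b * x 1 * star (x 0)).im) ∧
      ‖x‖ ^ 2 = ‖x 0‖ ^ 2 + ‖x 1‖ ^ 2 := by
    intro x
    have h0 : Matrix.toEuclideanLin !![l₁, b; 0, l₂] x 0 = l₁ * x 0 + b * x 1 := by
      simp [Matrix.toLpLin_apply, dotProduct, Fin.sum_univ_two]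
    have h1 : Matrix.toEuclideanLin !![l₁, b; 0, l₂] x 1 = l₂ * x 1 := by
      simp [Matrix.toLpLin_apply, dotProduct, Fin.sum_univ_two]
    refine ⟨?_, ?_, ?_⟩
    · rw [PiLp.inner_apply, Fin.sum_univ_two, h0, h1]
      simp only [RCLike.inner_apply, Complex.norm_sq_eq_re_im, Complex.add_re, Complex.mul_re,
        Complex.mul_im, Complex.add_im, Complex.star_def, Complex.conj_re, Complex.conj_im]
      ring
    · rw [EuclideanSpace.norm_sq_eq, Fin.sum_univ_two, h0, h1]
      simp only [Complex.norm_sq_eq_re_im, Complex.add_re, Complex.mul_re,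
        Complex.mul_im, Complex.add_im, Complex.star_def, Complex.conj_re, Complex.conj_im]
      ring
    · rw [EuclideanSpace.norm_sq_eq, Fin.sum_univ_two]
  constructor
  · rintro ⟨x, hx, h⟩
    obtain ⟨k1, k2, k3⟩ := key x
    refine ⟨x 0, x 1, ?_, by rw [h, k1, k2, k3]⟩
    by_contra! hc
    apply hx
    ext i
    fin_cases i
    · exact hc.1
    · exact hc.2
  · rintro ⟨ξ, η, hx, h⟩
    obtain ⟨k1, k2, k3⟩ := key (WithLp.toLp 2 ![ξ, η])
    refine ⟨WithLp.toLp 2 ![ξ, η], ?_, ?_⟩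
    · intro hc
      have e0 := congrArg (fun y : EuclideanSpace ℂ (Fin 2) => y 0) hc
      have e1 := congrArg (fun y : EuclideanSpace ℂ (Fin 2) => y 1) hc
      simp at e0 e1
      rcases hx with hx | hx
      · exact hx e0
      · exact hx e1
    · rw [h, k1, k2, k3]
      simp

/-- With `|Ax|² + |x|² = 1`, the coordinates and `t` determine `v = b * η * star ξ`: its real part
from `Re⟨Ax, x⟩`, its imaginary part from `|Ax|²`, since `l₁.im ≠ 0`. The only remaining condition
is `|v|² = ‖b‖² * |ξ|² * |η|²`, which is `fibreEq`. -/
lemma mem_conformalRange_iff_exists_fibreEq {l₁ l₂ b : ℂ} (h₁ : l₁.im ≠ 0) (p : ℝ × ℝ) :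
    p ∈ matrixConformalRange !![l₁, b; 0, l₂] ↔
      ∃ t, 0 ≤ t ∧ t ≤ (1 - p.2) / 2 ∧
        fibreEq l₁ l₂ b ((1 + p.2) / 2) (p.1 / 2) ((1 - p.2) / 2) t := by
  rw [mem_conformalRange_iff]
  constructor
  · rintro ⟨ξ, η, hx, h⟩
    have hv : ‖b * η * star ξ‖ ^ 2 = ‖b‖ ^ 2 * (‖ξ‖ ^ 2 * ‖η‖ ^ 2) := by
      rw [norm_mul, norm_mul, norm_star]; ring
    rw [Complex.norm_sq_eq_re_im] at hv
    have hP : 0 ≤ ‖l₁‖ ^ 2 * ‖ξ‖ ^ 2 + (‖b‖ ^ 2 + ‖l₂‖ ^ 2) * ‖η‖ ^ 2 +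
        2 * (l₁.re * (b * η * star ξ).re + l₁.im * (b * η * star ξ).im) := by
      have : ‖l₁‖ ^ 2 * ‖ξ‖ ^ 2 + (‖b‖ ^ 2 + ‖l₂‖ ^ 2) * ‖η‖ ^ 2 +
        2 * (l₁.re * (b * η * star ξ).re + l₁.im * (b * η * star ξ).im) =
          ‖l₁ * ξ + b * η‖ ^ 2 + ‖l₂ * η‖ ^ 2 := by
        simp only [Complex.norm_sq_eq_re_im, Complex.add_re, Complex.mul_re,
          Complex.mul_im, Complex.add_im, Complex.star_def, Complex.conj_re, Complex.conj_im]
        ring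
      rw [this]; positivity
    have hR : 0 < ‖ξ‖ ^ 2 + ‖η‖ ^ 2 := by
      rcases hx with hx | hx
      · have := norm_pos_iff.2 hx; positivity
      · have := norm_pos_iff.2 hx; positivity
    set v₁ := (b * η * star ξ).re
    set v₂ := (b * η * star ξ).im
    set s := ‖ξ‖ ^ 2
    set t := ‖η‖ ^ 2 with ht
    have ht0 : 0 ≤ t := by positivity
    have hs0 : 0 ≤ s := by positivity
    set N := ‖l₁‖ ^ 2 * s + (‖b‖ ^ 2 + ‖l₂‖ ^ 2) * t + 2 * (l₁.re * v₁ + l₁.im * v₂) + (s + t)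
      with hN
    have hN0 : 0 < N := by linarith
    have e1 : p.1 / 2 = (l₁.re * s + l₂.re * t + v₁) / N := by
      rw [h]; ring
    have e2 : (1 + p.2) / 2 =
        (‖l₁‖ ^ 2 * s + (‖b‖ ^ 2 + ‖l₂‖ ^ 2) * t + 2 * (l₁.re * v₁ + l₁.im * v₂)) / N := by
      rw [h, hN]; field_simp; ring
    have e3 : (1 - p.2) / 2 = (s + t) / N := by
      rw [h, hN]; field_simp; ring
    clear_value N
    refine ⟨t / N, by positivity, ?_, ?_⟩
    · rw [e3]; gcongr; linarith
    · rw [fibreEq, e1, e2, e3]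
      have f1 : (l₁.re * s + l₂.re * t + v₁) / N - l₁.re * ((s + t) / N)
          - (l₂.re - l₁.re) * (t / N) = v₁ / N := by ring
      have f2 : (s + t) / N - t / N = s / N := by ring
      have f3 : (‖l₁‖ ^ 2 * s + (‖b‖ ^ 2 + ‖l₂‖ ^ 2) * t + 2 * (l₁.re * v₁ + l₁.im * v₂)) / N
          - ‖l₁‖ ^ 2 * (s / N) - (‖b‖ ^ 2 + ‖l₂‖ ^ 2) * (t / N) - 2 * l₁.re * (v₁ / N) =
          2 * l₁.im * v₂ / N := by ring
      rw [f1, f2, f3]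
      linear_combination (4 * l₁.im ^ 2 / N ^ 2) * hv
  · rintro ⟨t, ht0, htR, h⟩
    rw [fibreEq] at h
    set v₁ := p.1 / 2 - l₁.re * ((1 - p.2) / 2) - (l₂.re - l₁.re) * t with hv₁
    set v₂ := ((1 + p.2) / 2 - ‖l₁‖ ^ 2 * ((1 - p.2) / 2 - t) - (‖b‖ ^ 2 + ‖l₂‖ ^ 2) * t
      - 2 * l₁.re * v₁) / (2 * l₁.im) with hv₂
    have hv₂' : (1 + p.2) / 2 - ‖l₁‖ ^ 2 * ((1 - p.2) / 2 - t) - (‖b‖ ^ 2 + ‖l₂‖ ^ 2) * t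
      - 2 * l₁.re * v₁ = 2 * l₁.im * v₂ := by rw [hv₂]; field_simp
    rw [hv₂'] at h
    have hsum : v₁ ^ 2 + v₂ ^ 2 = ‖b‖ ^ 2 * (((1 - p.2) / 2 - t) * t) := by
      have : 4 * l₁.im ^ 2 ≠ 0 := by positivity
      apply mul_left_cancel₀ this
      linarith
    obtain ⟨ξ, η, hξ, hη, hv⟩ := exists_sq_norm_eq (b := b) (v := ⟨v₁, v₂⟩)
      (s := (1 - p.2) / 2 - t) (t := t) (by linarith) ht0
      (by rw [Complex.norm_sq_eq_re_im]; exact hsum)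
    have hPP : ‖l₁‖ ^ 2 * ((1 - p.2) / 2 - t) + (‖b‖ ^ 2 + ‖l₂‖ ^ 2) * t +
        2 * (l₁.re * v₁ + l₁.im * v₂) = (1 + p.2) / 2 := by linarith
    refine ⟨ξ, η, ?_, ?_⟩
    -- If `ξ = η = 0`, both `|Ax|²` and `|x|²` vanish, though they must sum to `1`.
    · by_contra! hc
      rw [hc.1] at hξ
      rw [hc.2] at hη
      simp only [norm_zero, ne_eq, OfNat.ofNat_ne_zero, not_false_eq_true, zero_pow] at hξ hη
      have hv1 : v₁ = 0 := by simpa [hc.2] using (congrArg Complex.re hv).symm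
      have hv2 : v₂ = 0 := by simpa [hc.2] using (congrArg Complex.im hv).symm
      rw [hv1, hv2, ← hξ, ← hη] at hPP
      linarith
    · rw [hξ, hη, hv]
      simp only
      rw [hPP]
      ext
      · simp only
        rw [hv₁]
        ring
      · simp only
        ring

/-- The hyperbolic cosine of the distance sum. -/
def triangularCosh (l₁ l₂ b : ℂ) : ℝ :=
  (‖b‖ ^ 2 + ((l₁.re - l₂.re) ^ 2 + l₁.im ^ 2 + l₂.im ^ 2)) / (2 * |l₁.im * l₂.im|)

lemma exists_quadratic_iff {A B C : ℝ} (hA : 0 < A) :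
    (∃ t, A * t ^ 2 - 2 * B * t + C = 0) ↔ 0 ≤ B ^ 2 - A * C := by
  constructor
  · rintro ⟨t, ht⟩
    have : B ^ 2 - A * C = (A * t - B) ^ 2 := by linear_combination -A * ht
    rw [this]; positivity
  · intro h
    refine ⟨(B + √(B ^ 2 - A * C)) / A, ?_⟩
    have := Real.sq_sqrt h
    field_simp
    linear_combination this

/-- The solvability on `[0, R]` of the fibre equation in terms of its discriminant. -/
lemma exists_mem_Icc_iff_discrim {β a₁ a₂ y₁ y₂ P Q R N₁ N₂ σ : ℝ} (hβ : 0 < β) (h₁ : y₁ ≠ 0)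
    (h₂ : y₂ ≠ 0) (hR : 0 ≤ R) (hN₁ : N₁ = P - 2 * a₁ * Q + (a₁ ^ 2 + y₁ ^ 2) * R)
    (hN₂ : N₂ = P - 2 * a₂ * Q + (a₂ ^ 2 + y₂ ^ 2) * R)
    (hσ : σ = β + ((a₁ - a₂) ^ 2 + y₁ ^ 2 + y₂ ^ 2)) :
    (∃ t, 0 ≤ t ∧ t ≤ R ∧ 4 * y₁ ^ 2 * (Q - a₁ * R - (a₂ - a₁) * t) ^ 2 +
        (P - (a₁ ^ 2 + y₁ ^ 2) * (R - t) - (β + (a₂ ^ 2 + y₂ ^ 2)) * t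
          - 2 * a₁ * (Q - a₁ * R - (a₂ - a₁) * t)) ^ 2 = 4 * y₁ ^ 2 * (β * ((R - t) * t))) ↔
      0 ≤ y₁ ^ 2 * N₂ ^ 2 + y₂ ^ 2 * N₁ ^ 2 - σ * N₁ * N₂ +
        (σ ^ 2 - 4 * y₁ ^ 2 * y₂ ^ 2) * (P * R - Q ^ 2) := by
  have hA : 0 < σ ^ 2 - 4 * y₁ ^ 2 * y₂ ^ 2 := by
    have : σ ^ 2 - 4 * y₁ ^ 2 * y₂ ^ 2 =
      (β + (a₁ - a₂) ^ 2) * (β + (a₁ - a₂) ^ 2 + 2 * (y₁ ^ 2 + y₂ ^ 2)) +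
        (y₁ ^ 2 - y₂ ^ 2) ^ 2 := by rw [hσ]; ring
    rw [this]; positivity
  have hfib : ∀ t, 4 * y₁ ^ 2 * (Q - a₁ * R - (a₂ - a₁) * t) ^ 2 +
        (P - (a₁ ^ 2 + y₁ ^ 2) * (R - t) - (β + (a₂ ^ 2 + y₂ ^ 2)) * t
          - 2 * a₁ * (Q - a₁ * R - (a₂ - a₁) * t)) ^ 2 - 4 * y₁ ^ 2 * (β * ((R - t) * t)) =
      (σ ^ 2 - 4 * y₁ ^ 2 * y₂ ^ 2) * t ^ 2 -
        2 * (σ * N₁ - 2 * y₁ ^ 2 * N₂) * t + (N₁ ^ 2 - 4 * y₁ ^ 2 * (P * R - Q ^ 2)) := by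
    intro t
    rw [hσ, hN₁, hN₂]
    ring
  have hdisc : (σ * N₁ - 2 * y₁ ^ 2 * N₂) ^ 2 -
      (σ ^ 2 - 4 * y₁ ^ 2 * y₂ ^ 2) * (N₁ ^ 2 - 4 * y₁ ^ 2 * (P * R - Q ^ 2)) =
      4 * y₁ ^ 2 * (y₁ ^ 2 * N₂ ^ 2 + y₂ ^ 2 * N₁ ^ 2 - σ * N₁ * N₂ +
        (σ ^ 2 - 4 * y₁ ^ 2 * y₂ ^ 2) * (P * R - Q ^ 2)) := by
    ring
  have hpos : 0 < 4 * y₁ ^ 2 := by positivity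
  rw [← mul_nonneg_iff_of_pos_left hpos, ← hdisc, ← exists_quadratic_iff hA]
  constructor
  · rintro ⟨t, -, -, h⟩
    exact ⟨t, by rw [← hfib t]; linarith⟩
  · rintro ⟨t, h⟩
    rw [← hfib t, sub_eq_zero] at h
    -- The left side of the fibre equation is a sum of squares, so every real root lies in `[0, R]`
    -- automatically.
    have h3 : 0 ≤ (R - t) * t := by
      have : 0 ≤ 4 * y₁ ^ 2 * (β * ((R - t) * t)) := by
        rw [← h]; positivity
      rwa [mul_nonneg_iff_of_pos_left hpos, mul_nonneg_iff_of_pos_left hβ] at this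
    refine ⟨t, ?_, ?_, h⟩
    · by_contra! ht
      exact absurd h3 (not_le.2 (mul_neg_of_pos_of_neg (by linarith) ht))
    · by_contra! ht
      exact absurd h3 (not_le.2 (mul_neg_of_neg_of_pos (by linarith) (by linarith)))

lemma mink_focusVec_one {l : ℂ} (hl : l.im ≠ 0) (p : ℝ × ℝ) :
    mink (focusVec l) (1, p) = ((1 + p.2) / 2 - 2 * l.re * (p.1 / 2) +
      (l.re ^ 2 + l.im ^ 2) * ((1 - p.2) / 2)) / |l.im| := by
  have h0 : 0 < |l.im| := abs_pos.2 hl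
  simp only [mink, focusVec]
  field_simp
  ring

lemma exists_fibreEq_iff {l₁ l₂ b : ℂ} (h₁ : l₁.im ≠ 0) (h₂ : l₂.im ≠ 0) (hb : b ≠ 0)
    {p : ℝ × ℝ} (hp : p.2 ≤ 1) :
    (∃ t, 0 ≤ t ∧ t ≤ (1 - p.2) / 2 ∧
        fibreEq l₁ l₂ b ((1 + p.2) / 2) (p.1 / 2) ((1 - p.2) / 2) t) ↔
      0 ≤ ellipseForm (focusVec l₁) (focusVec l₂) (triangularCosh l₁ l₂ b) (1, p) := by
  have hb' : 0 < ‖b‖ ^ 2 := by have := norm_pos_iff.2 hb; positivity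
  have h1 : 0 < |l₁.im| := abs_pos.2 h₁
  have h2 : 0 < |l₂.im| := abs_pos.2 h₂
  simp only [fibreEq, Complex.norm_sq_eq_re_im l₁, Complex.norm_sq_eq_re_im l₂]
  rw [exists_mem_Icc_iff_discrim hb' h₁ h₂ (by linarith) rfl rfl rfl, ellipseForm, mink_focusVec_one h₁, mink_focusVec_one h₂,
    triangularCosh, abs_mul]
  have hm : mink (1, p) (1, p) =
      4 * ((1 + p.2) / 2 * ((1 - p.2) / 2) - (p.1 / 2) ^ 2) := by
    simp only [mink]; ring
  rw [hm]
  generalize (1 + p.2) / 2 - 2 * l₁.re * (p.1 / 2) +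
    (l₁.re ^ 2 + l₁.im ^ 2) * ((1 - p.2) / 2) = N₁
  generalize (1 + p.2) / 2 - 2 * l₂.re * (p.1 / 2) +
    (l₂.re ^ 2 + l₂.im ^ 2) * ((1 - p.2) / 2) = N₂
  generalize ‖b‖ ^ 2 + ((l₁.re - l₂.re) ^ 2 + l₁.im ^ 2 + l₂.im ^ 2) = σ
  generalize (1 + p.2) / 2 * ((1 - p.2) / 2) - (p.1 / 2) ^ 2 = D
  rw [← sq_abs l₁.im, ← sq_abs l₂.im]
  generalize |l₁.im| = y₁ at *
  generalize |l₂.im| = y₂ at *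
  -- `N₁ / y₁` and `N₂ / y₂` are the products of the foci with `(1, p)`, and `4 * D` is the norm of
  -- `(1, p)`.
  have : y₁ ^ 2 * N₂ ^ 2 + y₂ ^ 2 * N₁ ^ 2 - σ * N₁ * N₂ + (σ ^ 2 - 4 * y₁ ^ 2 * y₂ ^ 2) * D =
      y₁ ^ 2 * y₂ ^ 2 * ((N₁ / y₁) ^ 2 + (N₂ / y₂) ^ 2 -
        2 * (σ / (2 * (y₁ * y₂))) * (N₁ / y₁) * (N₂ / y₂) +
        ((σ / (2 * (y₁ * y₂))) ^ 2 - 1) * (4 * D)) := by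
    field_simp
    ring
  rw [this, mul_nonneg_iff_of_pos_left (by positivity)]

lemma conformalRange_subset {H : Type*} [NormedAddCommGroup H] [InnerProductSpace ℂ H]
    (T : H →ₗ[ℂ] H) {p : ℝ × ℝ} (hp : p ∈ conformalRange T) : p.1 ^ 2 + p.2 ^ 2 ≤ 1 := by
  obtain ⟨x, hx, rfl⟩ := hp
  have h0 := norm_pos_iff.2 hx
  have h1 : |(inner ℂ (T x) x).re| ≤ ‖T x‖ * ‖x‖ :=
    (Complex.abs_re_le_norm _).trans (norm_inner_le_norm _ _)
  have h2 : (inner ℂ (T x) x).re ^ 2 ≤ (‖T x‖ * ‖x‖) ^ 2 := by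
    rw [← sq_abs]; gcongr
  simp only [div_pow]
  rw [← add_div, div_le_one (by positivity)]
  linarith

lemma snd_le_one_of_sq_add_sq_le {p : ℝ × ℝ} (hp : p.1 ^ 2 + p.2 ^ 2 ≤ 1) : p.2 ≤ 1 := by
  nlinarith [sq_nonneg p.1, sq_nonneg (p.2 - 1)]

lemma mink_focusVec_lt {l₁ l₂ b : ℂ} (h₁ : l₁.im ≠ 0) (h₂ : l₂.im ≠ 0) (hb : b ≠ 0) :
    mink (focusVec l₁) (focusVec l₂) < triangularCosh l₁ l₂ b := by
  rw [mink_focusVec h₁ h₂, triangularCosh]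
  have := norm_pos_iff.2 hb
  have h0 : 0 < |l₁.im * l₂.im| := abs_pos.2 (mul_ne_zero h₁ h₂)
  have : 0 < ‖b‖ ^ 2 := by positivity
  exact div_lt_div_of_pos_right (by linarith) (by positivity)

theorem conformalRange_triangular {l₁ l₂ b : ℂ} (h₁ : l₁.im ≠ 0) (h₂ : l₂.im ≠ 0) (hb : b ≠ 0) :
    matrixConformalRange !![l₁, b; 0, l₂] =
      hEllipticalDisk (hParam l₁) (hParam l₂) (Real.arcosh (triangularCosh l₁ l₂ b)) := by
  rw [← kleinProj_focusVec h₁, ← kleinProj_focusVec h₂,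
    hEllipticalDisk_eq_of_lt (focusVec_mem h₁) (focusVec_mem h₂) (mink_focusVec_lt h₁ h₂ hb)]
  ext p
  constructor
  · intro hp
    have hp1 := conformalRange_subset _ hp
    exact ⟨hp1, (exists_fibreEq_iff h₁ h₂ hb (snd_le_one_of_sq_add_sq_le hp1)).1
      ((mem_conformalRange_iff_exists_fibreEq h₁ p).1 hp)⟩
  · rintro ⟨hp1, hp⟩
    exact (mem_conformalRange_iff_exists_fibreEq h₁ p).2
      ((exists_fibreEq_iff h₁ h₂ hb (snd_le_one_of_sq_add_sq_le hp1)).2 hp)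

/-- For `b = 0` both squares in the fibre equation must vanish, leaving linear equations that
describe the segment. -/
theorem conformalRange_diagonal {l₁ l₂ : ℂ} (h₁ : l₁.im ≠ 0) :
    matrixConformalRange !![l₁, 0; 0, l₂] = segment ℝ (hParam l₁) (hParam l₂) := by
  have hl1 : 0 < ‖l₁‖ ^ 2 + 1 := by positivity
  have hl2 : 0 < ‖l₂‖ ^ 2 + 1 := by positivity
  ext p
  rw [mem_conformalRange_iff_exists_fibreEq h₁]
  simp only [fibreEq, norm_zero]
  constructor
  · rintro ⟨t, ht0, htR, h⟩
    set R := (1 - p.2) / 2 with hR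
    have e1 : p.1 / 2 - l₁.re * R - (l₂.re - l₁.re) * t = 0 := by
      have hpos : 0 < 4 * l₁.im ^ 2 := by positivity
      have : (p.1 / 2 - l₁.re * R - (l₂.re - l₁.re) * t) ^ 2 = 0 := by nlinarith
      simpa using this
    rw [e1] at h
    have e2 : (1 + p.2) / 2 - ‖l₁‖ ^ 2 * (R - t) - ‖l₂‖ ^ 2 * t = 0 := by
      have : ((1 + p.2) / 2 - ‖l₁‖ ^ 2 * (R - t) - ‖l₂‖ ^ 2 * t) ^ 2 = 0 := by linarith
      simpa using this
    -- The weights sum to `|x|² + |Ax|² = 1`.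
    refine ⟨(R - t) * (‖l₁‖ ^ 2 + 1), t * (‖l₂‖ ^ 2 + 1), mul_nonneg (by linarith) hl1.le,
      by positivity, by linarith, ?_⟩
    ext
    · simp only [hParam, Prod.fst_add, Prod.smul_fst, smul_eq_mul]
      field_simp
      linarith
    · simp only [hParam, Prod.snd_add, Prod.smul_snd, smul_eq_mul]
      field_simp
      linarith
  · rintro ⟨w₁, w₂, hw₁, hw₂, hw, rfl⟩
    simp only [hParam, Prod.snd_add, Prod.smul_snd, smul_eq_mul, Prod.fst_add, Prod.smul_fst]
    set n₁ := ‖l₁‖ ^ 2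
    set n₂ := ‖l₂‖ ^ 2
    have hR : (1 - (w₁ * ((n₁ - 1) / (n₁ + 1)) + w₂ * ((n₂ - 1) / (n₂ + 1)))) / 2 =
        w₁ / (n₁ + 1) + w₂ / (n₂ + 1) := by
      obtain rfl : w₁ = 1 - w₂ := by linarith
      field_simp; ring
    have hP : (1 + (w₁ * ((n₁ - 1) / (n₁ + 1)) + w₂ * ((n₂ - 1) / (n₂ + 1)))) / 2 =
        n₁ * (w₁ / (n₁ + 1)) + n₂ * (w₂ / (n₂ + 1)) := by
      obtain rfl : w₁ = 1 - w₂ := by linarith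
      field_simp; ring
    rw [hR, hP]
    refine ⟨w₂ / (n₂ + 1), by positivity, ?_, ?_⟩
    · have : 0 ≤ w₁ / (n₁ + 1) := by positivity
      linarith
    · ring

/-! ### Unitary invariance and Schur triangularization -/

lemma conformalRange_conj {U : Matrix (Fin 2) (Fin 2) ℂ} (hU : Uᴴ * U = 1)
    (T : Matrix (Fin 2) (Fin 2) ℂ) :
    matrixConformalRange (U * T * Uᴴ) = matrixConformalRange T := by
  have hU' : U * Uᴴ = 1 := mul_eq_one_comm.1 hU
  have hinner : ∀ V : Matrix (Fin 2) (Fin 2) ℂ, Vᴴ * V = 1 → ∀ x y : EuclideanSpace ℂ (Fin 2),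
      inner ℂ (Matrix.toEuclideanLin V x) (Matrix.toEuclideanLin V y) = inner ℂ x y := by
    intro V hV x y
    rw [← LinearMap.adjoint_inner_right, ← Matrix.toEuclideanLin_conjTranspose_eq_adjoint,
      ← LinearMap.comp_apply, ← Matrix.toLpLin_mul_same, hV, Matrix.toLpLin_one,
      LinearMap.id_apply]
  have hnorm : ∀ V : Matrix (Fin 2) (Fin 2) ℂ, Vᴴ * V = 1 → ∀ x : EuclideanSpace ℂ (Fin 2),
      ‖Matrix.toEuclideanLin V x‖ = ‖x‖ := by
    intro V hV x
    rw [@norm_eq_sqrt_re_inner ℂ, @norm_eq_sqrt_re_inner ℂ _ _ _ _ x, hinner V hV]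
  have hsub : ∀ V S : Matrix (Fin 2) (Fin 2) ℂ, Vᴴ * V = 1 →
      matrixConformalRange S ⊆ matrixConformalRange (V * S * Vᴴ) := by
    rintro V S hV p ⟨x, hx, rfl⟩
    have e : Matrix.toEuclideanLin (V * S * Vᴴ) (Matrix.toEuclideanLin V x) =
        Matrix.toEuclideanLin V (Matrix.toEuclideanLin S x) := by
      rw [← LinearMap.comp_apply, ← LinearMap.comp_apply, ← Matrix.toLpLin_mul_same,
        ← Matrix.toLpLin_mul_same, Matrix.mul_assoc, hV, Matrix.mul_one]
    refine ⟨Matrix.toEuclideanLin V x, ?_, ?_⟩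
    · rw [← norm_pos_iff, hnorm V hV]
      exact norm_pos_iff.2 hx
    · rw [e, hinner V hV, hnorm V hV, hnorm V hV]
  refine Set.Subset.antisymm ?_ (hsub U T hU)
  have h := hsub Uᴴ (U * T * Uᴴ) (by rw [Matrix.conjTranspose_conjTranspose]; exact hU')
  have e : Uᴴ * (U * T * Uᴴ) * Uᴴᴴ = T := by
    rw [Matrix.conjTranspose_conjTranspose]
    calc Uᴴ * (U * T * Uᴴ) * U = (Uᴴ * U) * T * (Uᴴ * U) := by simp only [Matrix.mul_assoc]
      _ = T := by rw [hU, Matrix.one_mul, Matrix.mul_one]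
  rwa [e] at h

lemma trace_conj {U : Matrix (Fin 2) (Fin 2) ℂ} (hU : Uᴴ * U = 1)
    (T : Matrix (Fin 2) (Fin 2) ℂ) : (U * T * Uᴴ).trace = T.trace := by
  rw [Matrix.trace_mul_comm, ← Matrix.mul_assoc, hU, Matrix.one_mul]

lemma det_conj_unitary {U : Matrix (Fin 2) (Fin 2) ℂ} (hU : Uᴴ * U = 1)
    (T : Matrix (Fin 2) (Fin 2) ℂ) : (U * T * Uᴴ).det = T.det := by
  have h : Uᴴ.det * U.det = 1 := by rw [← Matrix.det_mul, hU, Matrix.det_one]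
  rw [Matrix.det_mul, Matrix.det_mul]
  linear_combination T.det * h

lemma conjTranspose_conj (U T : Matrix (Fin 2) (Fin 2) ℂ) :
    (U * T * Uᴴ)ᴴ = U * Tᴴ * Uᴴ := by
  simp only [Matrix.conjTranspose_mul, Matrix.conjTranspose_conjTranspose, Matrix.mul_assoc]

lemma conj_mul_conj {U : Matrix (Fin 2) (Fin 2) ℂ} (hU : Uᴴ * U = 1)
    (S T : Matrix (Fin 2) (Fin 2) ℂ) : (U * S * Uᴴ) * (U * T * Uᴴ) = U * (S * T) * Uᴴ := by
  calc (U * S * Uᴴ) * (U * T * Uᴴ) = U * S * (Uᴴ * U) * T * Uᴴ := by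
        simp only [Matrix.mul_assoc]
    _ = U * (S * T) * Uᴴ := by rw [hU, Matrix.mul_one, Matrix.mul_assoc U]

lemma discD_conj {U : Matrix (Fin 2) (Fin 2) ℂ} (hU : Uᴴ * U = 1)
    (T : Matrix (Fin 2) (Fin 2) ℂ) : discD (U * T * Uᴴ) = discD T := by
  rw [discD, discD, det_conj_unitary hU, trace_conj hU]

lemma discU_conj {U : Matrix (Fin 2) (Fin 2) ℂ} (hU : Uᴴ * U = 1)
    (T : Matrix (Fin 2) (Fin 2) ℂ) : discU (U * T * Uᴴ) = discU T := by
  rw [discU, discU, conjTranspose_conj, conj_mul_conj hU, trace_conj hU, trace_conj hU]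

lemma discE_conj {U : Matrix (Fin 2) (Fin 2) ℂ} (hU : Uᴴ * U = 1)
    (T : Matrix (Fin 2) (Fin 2) ℂ) : discE (U * T * Uᴴ) = discE T := by
  rw [discE, discE, discD_conj hU, trace_conj hU]

lemma normal_conj_iff {U : Matrix (Fin 2) (Fin 2) ℂ} (hU : Uᴴ * U = 1)
    (T : Matrix (Fin 2) (Fin 2) ℂ) :
    (U * T * Uᴴ)ᴴ * (U * T * Uᴴ) = (U * T * Uᴴ) * (U * T * Uᴴ)ᴴ ↔ Tᴴ * T = T * Tᴴ := by
  rw [conjTranspose_conj, conj_mul_conj hU, conj_mul_conj hU]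
  constructor
  · intro h
    have e : ∀ S : Matrix (Fin 2) (Fin 2) ℂ, Uᴴ * (U * S * Uᴴ) * U = S := by
      intro S
      calc Uᴴ * (U * S * Uᴴ) * U = (Uᴴ * U) * S * (Uᴴ * U) := by simp only [Matrix.mul_assoc]
        _ = S := by rw [hU, Matrix.one_mul, Matrix.mul_one]
    rw [← e (Tᴴ * T), h, e]
  · intro h; rw [h]

lemma exists_mulVec_of_mem_roots {A : Matrix (Fin 2) (Fin 2) ℂ} {l : ℂ}
    (hl : l ∈ A.charpoly.roots) : ∃ v : Fin 2 → ℂ, v ≠ 0 ∧ A *ᵥ v = l • v := by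
  have h := (Polynomial.mem_roots'.1 hl).2
  rw [Polynomial.IsRoot, Matrix.eval_charpoly] at h
  obtain ⟨v, hv, h⟩ := Matrix.exists_mulVec_eq_zero_iff.2 h
  refine ⟨v, hv, ?_⟩
  rw [Matrix.sub_mulVec, sub_eq_zero] at h
  rw [← h]
  ext i
  simp

/-- Schur triangularization. -/
lemma exists_triangular {A : Matrix (Fin 2) (Fin 2) ℂ} {l₁ l₂ : ℂ}
    (hl : A.charpoly.roots = {l₁, l₂}) :
    ∃ (U : Matrix (Fin 2) (Fin 2) ℂ) (b : ℂ), Uᴴ * U = 1 ∧ A = U * !![l₁, b; 0, l₂] * Uᴴ := by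
  obtain ⟨v, hv, hAv⟩ := exists_mulVec_of_mem_roots (A := A) (l := l₁) (by rw [hl]; simp)
  have hn : 0 < ‖v 0‖ ^ 2 + ‖v 1‖ ^ 2 := by
    by_contra! h
    apply hv
    have h0 : ‖v 0‖ = 0 := by nlinarith [sq_nonneg ‖v 0‖, sq_nonneg ‖v 1‖]
    have h1 : ‖v 1‖ = 0 := by nlinarith [sq_nonneg ‖v 0‖, sq_nonneg ‖v 1‖]
    ext i
    fin_cases i
    · exact norm_eq_zero.1 h0
    · exact norm_eq_zero.1 h1
  set r := √(‖v 0‖ ^ 2 + ‖v 1‖ ^ 2) with hr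
  have hr0 : 0 < r := Real.sqrt_pos.2 hn
  have hr2 : r ^ 2 = ‖v 0‖ ^ 2 + ‖v 1‖ ^ 2 := Real.sq_sqrt hn.le
  have hrC : (r : ℂ) ≠ 0 := by exact_mod_cast hr0.ne'
  have hrC2 : star (v 0) * v 0 + star (v 1) * v 1 = (r : ℂ) ^ 2 := by
    have : ∀ z : ℂ, star z * z = ((‖z‖ ^ 2 : ℝ) : ℂ) := fun z => by
      rw [Complex.star_def, Complex.conj_mul']; push_cast; rfl
    rw [this, this, ← Complex.ofReal_add, ← hr2]; push_cast; rfl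
  have hA0 : A 0 0 * v 0 + A 0 1 * v 1 = l₁ * v 0 := by
    have := congrFun hAv 0
    simpa [Matrix.mulVec, dotProduct, Fin.sum_univ_two] using this
  have hA1 : A 1 0 * v 0 + A 1 1 * v 1 = l₁ * v 1 := by
    have := congrFun hAv 1
    simpa [Matrix.mulVec, dotProduct, Fin.sum_univ_two] using this
  -- The normalized eigenvector, completed by its orthogonal complement. The remaining diagonal
  -- entry is later read off from the trace.
  set U : Matrix (Fin 2) (Fin 2) ℂ := !![v 0 / r, -star (v 1) / r; v 1 / r, star (v 0) / r]
    with hUdef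
  have hUH : Uᴴ = !![star (v 0) / r, star (v 1) / r; -v 1 / r, v 0 / r] := by
    ext i j
    fin_cases i <;> fin_cases j <;> simp [hUdef, Matrix.conjTranspose_apply]
  have hU : Uᴴ * U = 1 := by
    rw [hUH, hUdef]
    ext i j
    fin_cases i <;> fin_cases j <;>
      simp only [Matrix.mul_apply, Fin.sum_univ_two, Matrix.of_apply, Matrix.cons_val',
        Matrix.cons_val_zero, Matrix.cons_val_one, Fin.zero_eta, Fin.mk_one, Matrix.cons_val_fin_one, Matrix.one_apply_eq,
        ne_eq, zero_ne_one, one_ne_zero, not_false_eq_true, Matrix.one_apply_ne] <;>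
      field_simp
    · linear_combination hrC2
    · ring
    · ring
    · linear_combination hrC2
  have hU' : U * Uᴴ = 1 := mul_eq_one_comm.1 hU
  set T := Uᴴ * A * U with hT
  have hAT : A = U * T * Uᴴ := by
    calc A = (U * Uᴴ) * A * (U * Uᴴ) := by rw [hU', Matrix.one_mul, Matrix.mul_one]
      _ = U * T * Uᴴ := by rw [hT]; simp only [Matrix.mul_assoc]
  have htr : T 0 0 + T 1 1 = l₁ + l₂ := by
    have h1 := Matrix.trace_eq_sum_roots_charpoly A
    rw [hl] at h1
    rw [hAT, trace_conj hU, Matrix.trace_fin_two] at h1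
    simpa using h1
  have hT0 : T 0 0 = l₁ := by
    rw [hT, hUH, hUdef]
    simp only [Matrix.mul_apply, Fin.sum_univ_two, Matrix.of_apply, Matrix.cons_val',
      Matrix.cons_val_zero, Matrix.cons_val_one, Matrix.cons_val_fin_one]
    field_simp
    linear_combination star (v 0) * hA0 + star (v 1) * hA1 + l₁ * hrC2
  have hT1 : T 1 0 = 0 := by
    rw [hT, hUH, hUdef]
    simp only [Matrix.mul_apply, Fin.sum_univ_two, Matrix.of_apply, Matrix.cons_val',
      Matrix.cons_val_zero, Matrix.cons_val_one, Matrix.cons_val_fin_one]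
    field_simp
    linear_combination (-v 1) * hA0 + v 0 * hA1
  refine ⟨U, T 0 1, hU, ?_⟩
  have : T = !![l₁, T 0 1; 0, l₂] := by
    rw [Matrix.eta_fin_two T, hT0, hT1]
    rw [hT0] at htr
    have : T 1 1 = l₂ := by linear_combination htr
    rw [this]
    simp
  rwa [← this]

/-! ### Normality and discriminants of triangular matrices -/

lemma normal_triangular_iff (l₁ l₂ b : ℂ) :
    (!![l₁, b; 0, l₂]ᴴ * !![l₁, b; 0, l₂] = !![l₁, b; 0, l₂] * !![l₁, b; 0, l₂]ᴴ) ↔ b = 0 := by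
  constructor
  · intro h
    have h0 := congrFun (congrFun h 0) 0
    simp only [Matrix.mul_apply, Fin.sum_univ_two, Matrix.conjTranspose_apply] at h0
    simp [mul_comm] at h0
    exact h0
  · rintro rfl
    ext i j
    fin_cases i <;> fin_cases j <;> simp [Matrix.mul_apply, Fin.sum_univ_two, mul_comm]

lemma norm_discD_triangular (l₁ l₂ b : ℂ) :
    ‖discD !![l₁, b; 0, l₂]‖ = ((l₁.re - l₂.re) ^ 2 + (l₁.im - l₂.im) ^ 2) / 4 ∧
    (discD !![l₁, b; 0, l₂]).re = -((l₁.re - l₂.re) ^ 2 - (l₁.im - l₂.im) ^ 2) / 4 := by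
  have h : discD !![l₁, b; 0, l₂] = -((l₁ - l₂) ^ 2 / 4) := by
    rw [discD, Matrix.det_fin_two, Matrix.trace_fin_two]
    simp only [Matrix.of_apply, Matrix.cons_val', Matrix.cons_val_zero, Matrix.cons_val_one,
      Matrix.cons_val_fin_one]
    ring
  rw [h]
  constructor
  · rw [norm_neg, norm_div, norm_pow, Complex.norm_sq_eq_re_im]
    simp
  · simp [pow_two]
    ring

lemma disc_triangular (l₁ l₂ b : ℂ) :
    ‖discD !![l₁, b; 0, l₂]‖ - discE !![l₁, b; 0, l₂] = -(l₁.im * l₂.im) ∧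
    discU !![l₁, b; 0, l₂] + discE !![l₁, b; 0, l₂] =
      (‖b‖ ^ 2 + ((l₁.re - l₂.re) ^ 2 + l₁.im ^ 2 + l₂.im ^ 2)) / 2 := by
  obtain ⟨h1, h2⟩ := norm_discD_triangular l₁ l₂ b
  have hE : discE !![l₁, b; 0, l₂] = ((l₁.im + l₂.im) ^ 2 + (l₁.re - l₂.re) ^ 2) / 4 := by
    rw [discE, h1, h2, Matrix.trace_fin_two]
    simp only [Matrix.of_apply, Matrix.cons_val', Matrix.cons_val_zero, Matrix.cons_val_one,
      Matrix.cons_val_fin_one, Complex.add_im]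
    ring
  have hU : discU !![l₁, b; 0, l₂] =
      (‖l₁‖ ^ 2 + ‖l₂‖ ^ 2 + ‖b‖ ^ 2) / 2 - ‖l₁ + l₂‖ ^ 2 / 4 := by
    rw [discU, Matrix.trace_fin_two, Matrix.trace_fin_two]
    simp only [Matrix.mul_apply, Fin.sum_univ_two, Matrix.conjTranspose_apply, Matrix.of_apply,
      Matrix.cons_val', Matrix.cons_val_zero, Matrix.cons_val_one, Matrix.cons_val_fin_one,
      Complex.norm_sq_eq_re_im, Complex.add_re, Complex.mul_re, Complex.star_def, Complex.conj_re,
      Complex.conj_im, zero_mul, Complex.zero_re, Complex.zero_im]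
    ring
  refine ⟨by rw [h1, hE]; ring, ?_⟩
  rw [hU, hE]
  simp only [Complex.norm_sq_eq_re_im, Complex.add_re, Complex.add_im]
  ring

lemma ratio_triangular (l₁ l₂ b : ℂ) :
    (discU !![l₁, b; 0, l₂] + discE !![l₁, b; 0, l₂]) /
      |‖discD !![l₁, b; 0, l₂]‖ - discE !![l₁, b; 0, l₂]| = triangularCosh l₁ l₂ b := by
  obtain ⟨h1, h2⟩ := disc_triangular l₁ l₂ b
  rw [h1, h2, abs_neg, triangularCosh, div_div]

lemma im_ne_zero_of_mem_roots {A : Matrix (Fin 2) (Fin 2) ℂ}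
    (hA : ∀ r : ℝ, ¬ Module.End.HasEigenvalue (Matrix.toLin' A) (r : ℂ)) {l : ℂ}
    (hl : l ∈ A.charpoly.roots) : l.im ≠ 0 := by
  intro h
  obtain ⟨v, hv, hAv⟩ := exists_mulVec_of_mem_roots hl
  have hlr : ((l.re : ℝ) : ℂ) = l := by apply Complex.ext <;> simp [h]
  apply hA l.re
  rw [hlr]
  exact Module.End.hasEigenvalue_of_hasEigenvector
    (Module.End.hasEigenvector_iff.2 ⟨Module.End.mem_eigenspace_iff.2 (by simpa using hAv), hv⟩)

end

/-! ### The main theorem -/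

theorem mainTheorem4 (A : Matrix (Fin 2) (Fin 2) ℂ)
    (hA : ∀ r : ℝ, ¬ Module.End.HasEigenvalue (Matrix.toLin' A) (r : ℂ))
    (l₁ l₂ : ℂ) (hl : A.charpoly.roots = {l₁, l₂})
    (Λ₁ Λ₂ : ℝ × ℝ) (hΛ₁ : Λ₁ = hParam l₁) (hΛ₂ : Λ₂ = hParam l₂) :
    -- the data are well defined
    Λ₁ ∈ hPlane ∧ Λ₂ ∈ hPlane ∧ ‖discD A‖ ≠ discE A ∧
    1 ≤ (discU A + discE A) / |‖discD A‖ - discE A| ∧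
    -- the conformal range, and its boundary
    matrixConformalRange A = hEllipticalDisk Λ₁ Λ₂ (mPlus A) ∧
    frontier (matrixConformalRange A) = hEllipse Λ₁ Λ₂ (mPlus A) ∧
    -- the ellipse degenerates exactly for normal matrices
    hDist Λ₁ Λ₂ ≤ mPlus A ∧
    (hDist Λ₁ Λ₂ < mPlus A ↔ Aᴴ * A ≠ A * Aᴴ) ∧
    -- the distance sum is the length of the major axis
    (∃ P Q, IsMajorAxis (matrixConformalRange A) P Q) ∧
    (∀ P Q, IsMajorAxis (matrixConformalRange A) P Q → hDist P Q = mPlus A) := by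
  have h₁ : l₁.im ≠ 0 := im_ne_zero_of_mem_roots hA (by rw [hl]; simp)
  have h₂ : l₂.im ≠ 0 := im_ne_zero_of_mem_roots hA (by rw [hl]; simp)
  obtain ⟨U, b, hU, rfl⟩ := exists_triangular hl
  have hm₁ := focusVec_mem h₁
  have hm₂ := focusVec_mem h₂
  have hp₁ : Λ₁ ∈ hPlane := by rw [hΛ₁, ← kleinProj_focusVec h₁]; exact kleinProj_mem hm₁
  have hp₂ : Λ₂ ∈ hPlane := by rw [hΛ₂, ← kleinProj_focusVec h₂]; exact kleinProj_mem hm₂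
  have hd : hDist Λ₁ Λ₂ = Real.arcosh (mink (focusVec l₁) (focusVec l₂)) := by
    rw [hΛ₁, hΛ₂, ← kleinProj_focusVec h₁, ← kleinProj_focusVec h₂, hDist_kleinProj hm₁ hm₂]
  have hf := one_le_mink hm₁ hm₂
  have hlt : b ≠ 0 → mink (focusVec l₁) (focusVec l₂) < triangularCosh l₁ l₂ b :=
    mink_focusVec_lt h₁ h₂
  have heq : b = 0 → mink (focusVec l₁) (focusVec l₂) = triangularCosh l₁ l₂ b := by
    rintro rfl
    rw [mink_focusVec h₁ h₂, triangularCosh]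
    simp
  have hle : mink (focusVec l₁) (focusVec l₂) ≤ triangularCosh l₁ l₂ b := by
    by_cases hb : b = 0
    · exact (heq hb).le
    · exact (hlt hb).le
  rw [ne_eq (_ * _), normal_conj_iff hU, normal_triangular_iff, conformalRange_conj hU, mPlus,
    discD_conj hU, discU_conj hU, discE_conj hU, ratio_triangular]
  have hne : ‖discD !![l₁, b; 0, l₂]‖ ≠ discE !![l₁, b; 0, l₂] := by
    rw [← sub_ne_zero, (disc_triangular l₁ l₂ b).1]
    exact neg_ne_zero.2 (mul_ne_zero h₁ h₂)
  have hdle : hDist Λ₁ Λ₂ ≤ Real.arcosh (triangularCosh l₁ l₂ b) := by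
    rw [hd, Real.arcosh_le_arcosh (by linarith) (by linarith)]
    exact hle
  have hrange : matrixConformalRange !![l₁, b; 0, l₂] =
      hEllipticalDisk Λ₁ Λ₂ (Real.arcosh (triangularCosh l₁ l₂ b)) := by
    -- For `b = 0` the distance sum equals the focal distance, and the elliptical disk collapses to
    -- the segment.
    by_cases hb : b = 0
    · rw [← heq hb, ← hd, hEllipticalDisk_hDist hp₁ hp₂, hb, conformalRange_diagonal h₁, hΛ₁, hΛ₂]
    · rw [conformalRange_triangular h₁ h₂ hb, hΛ₁, hΛ₂]
  have hmajor := majorAxis_hEllipticalDisk hp₁ hp₂ hdle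
  rw [← hrange] at hmajor
  refine ⟨hp₁, hp₂, hne, hf.trans hle, hrange, ?_, hdle, ?_, hmajor⟩
  · rw [hrange]
    by_cases hb : b = 0
    · rw [← heq hb, ← hd, hEllipticalDisk_hDist hp₁ hp₂, hEllipse_hDist hp₁ hp₂,
        frontier_segment_prod]
    · rw [hΛ₁, hΛ₂, ← kleinProj_focusVec h₁, ← kleinProj_focusVec h₂,
        frontier_hEllipticalDisk_of_lt hm₁ hm₂ (hlt hb)]
  · rw [hd, Real.arcosh_lt_arcosh (by linarith) (by linarith)]
    constructor
    · intro h hb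
      exact absurd (heq hb) h.ne
    · exact hlt
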